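/- **Setting.** Let $\hat T\subset\mathbb R^2$ be the closed equilateral triangle with vertices $\hat{\mathbf z}_1=(-1,0)$, $\hat{\mathbf z}_2=(1,0)$, $\hat{\mathbf z}_3=(0,\sqrt3)$ (indices modulo 3), let $\hat F^i$ be the closed face opposite to $\hat{\mathbf z}_i$, and let $P_k(S)$ be the space of restrictions to $S$ of real polynomials in two variables of total degree at most $k$. Put $N_1=\frac12(1-x-y/\sqrt3)$, $N_2=\frac12(1+x-y/\sqrt3)$, $N_3=y/\sqrt3$. For a family $g_1,\dots,g_N$ of continuous functions on $X$, points $x_1,\dots,x_N\in X$ are called Fekete points if they maximise $|\det(g_j(x_i))_{i,j}|$ over all choices of $N$ points of $X$. *External interpolation.* Let $\Phi_k$ ($k\ge 0$) be real polynomials of one variable with $\deg\Phi_k=k$, let $m_i\ge2$, and set $N_i^{m_i,j}=N_{i+1}N_{i+2}\,\Phi_{j-2}(N_{i+2}-N_{i+1})$ for $2\le j\le m_i$. Let the nodes be the $m_i+1$ Gauss–Lobatto points of $\hat F^i$ (the affine images of $\pm1$ and of the zeros of the derivative of the Legendre polynomial of degree $m_i$), or, as an alternative description, Fekete points for a basis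 of $P_{m_i}(\hat F^i)$. For $f\in C(\hat F^i)$ let $$Ef|_{\hat F^i}=\Big(\sum_{j=2}^{m_i}c_{i,j}N_i^{m_i,j}+f(\hat{\mathbf z}_{i+1})N_{i+1}+f(\hat{\mathbf z}_{i+2})N_{i+2}\Big)\Big|_{\hat F^i},$$ with coefficients $c_{i,j}$ such that $Ef=f$ at all the nodes. *Internal interpolation.* Let $m\ge1$, $\hat m=(m-1)(m-2)/2$, and let $\mathcal I_m(\hat T)=\operatorname{span}\{N_1N_2N_3\,v: v\in P_{m-3}(\hat T)\}$ (which is $\{0\}$ for $m<3$), with a basis $\mathring N_1,\dots,\mathring N_{\hat m}$. Let $\mathbf z_1^*,\dots,\mathbf z^*_{\hat m}\in\hat T$ be Fekete points for this basis. For $f\in C(\hat T)$ let $If=\sum_{k=1}^{\hat m}a_k\mathring N_k$ with $If(\mathbf z_j^*)=f(\mathbf z_j^*)$ for $j=1,\dots,\hat m$. **Theorem.** The coefficients defining $Ef$ and $If$ exist and are unique. There is an absolute constant $C>0$ (independent of $i$, $m_i$, the $\Phi_k$, the nodes and $f$) such that for $i=1,2,3$ and all $m_i\ge2$ $$\|Ef\|_{\infty,\hat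 F^i}\le C\,\log (m_i)\,\|f\|_{\infty,\hat F^i}\qquad\forall f\in C(\hat F^i),$$ and for all $m\ge 1$ $$\|If\|_{\infty,\hat T}\le \hat m\,\|f\|_{\infty,\hat T}\qquad\forall f\in C(\hat T).$$ -/

import Mathlib

noncomputable section

namespace HPInterp

open Polynomial

/-- The reference equilateral triangle, as a subset of the plane. -/
def refTriangle : Set (ℝ × ℝ) :=
  {z | 0 ≤ z.2 ∧
    ((z.2 ≤ (1 + z.1) * Real.sqrt 3 ∧ -1 ≤ z.1 ∧ z.1 ≤ 0) ∨
      (z.2 ≤ (1 - z.1) * Real.sqrt 3 ∧ 0 ≤ z.1 ∧ z.1 ≤ 1))}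

/-- The vertices `(-1,0)`, `(1,0)`, `(0,√3)`. Indices live in `Fin 3`, so `i + 1` and `i + 2`
are read modulo 3. -/
def vertex : Fin 3 → ℝ × ℝ := ![(-1, 0), (1, 0), (0, Real.sqrt 3)]

/-- The closed face of the reference triangle opposite to the vertex `i`. -/
def face (i : Fin 3) : Set (ℝ × ℝ) := segment ℝ (vertex (i + 1)) (vertex (i + 2))

instance : CompactSpace refTriangle := by
  apply isCompact_iff_compactSpace.mp
  apply (isCompact_Icc (a := ((-1, 0) : ℝ × ℝ)) (b := (1, Real.sqrt 3))).of_isClosed_subset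
  · simp only [refTriangle, Set.ofPred_and, Set.ofPred_or]
    exact (isClosed_le continuous_const continuous_snd).inter
      (((isClosed_le continuous_snd (by fun_prop)).inter
        ((isClosed_le continuous_const continuous_fst).inter
          (isClosed_le continuous_fst continuous_const))).union
      ((isClosed_le continuous_snd (by fun_prop)).inter
        ((isClosed_le continuous_const continuous_fst).inter
          (isClosed_le continuous_fst continuous_const))))
  · rintro ⟨x, y⟩ ⟨h0, h | h⟩ <;>
    · have h3 := Real.sqrt_nonneg 3
      obtain ⟨h1, h2, h4⟩ := h
      simp only [Set.mem_Icc, Prod.mk_le_mk] at *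
      exact ⟨⟨by linarith, h0⟩, by linarith, by nlinarith⟩

instance (i : Fin 3) : CompactSpace (face i) := by
  apply isCompact_iff_compactSpace.mp
  rw [face, ← convexHull_pair (𝕜 := ℝ)]
  exact Set.Finite.isCompact_convexHull (𝕜 := ℝ) (Set.toFinite _)

/-- The two end points of the face `i`. -/
def faceLeft (i : Fin 3) : face i := ⟨vertex (i + 1), left_mem_segment ℝ _ _⟩

def faceRight (i : Fin 3) : face i := ⟨vertex (i + 2), right_mem_segment ℝ _ _⟩

/-- The nodal shape functions (the barycentric coordinates). -/
def nodal : Fin 3 → C(ℝ × ℝ, ℝ) :=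
  ![⟨fun z => (1 - z.1 - z.2 / Real.sqrt 3) / 2, by fun_prop⟩,
    ⟨fun z => (1 + z.1 - z.2 / Real.sqrt 3) / 2, by fun_prop⟩,
    ⟨fun z => z.2 / Real.sqrt 3, by fun_prop⟩]

/-- The side shape function of degree `k + 2` of the face `i`, built from the polynomial `Φ k`
of degree `k`. -/
def sideShape (Φ : ℕ → ℝ[X]) (i : Fin 3) (k : ℕ) : C(ℝ × ℝ, ℝ) :=
  nodal (i + 1) * nodal (i + 2) *
    ⟨fun z => (Φ k).eval (nodal (i + 2) z - nodal (i + 1) z), by fun_prop⟩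

/-- Restriction to `S` of the polynomials in two variables. -/
def polyRestrict (S : Set (ℝ × ℝ)) : MvPolynomial (Fin 2) ℝ →ₐ[ℝ] C(S, ℝ) :=
  MvPolynomial.aeval ![⟨fun z => z.1.1, by fun_prop⟩, ⟨fun z => z.1.2, by fun_prop⟩]

/-- `P_m(S)`: the polynomial functions on `S` of total degree at most `m`. -/
def polySpace (S : Set (ℝ × ℝ)) (m : ℕ) : Submodule ℝ C(S, ℝ) :=
  (MvPolynomial.restrictTotalDegree (Fin 2) ℝ m).map (polyRestrict S).toLinearMap

/-- The basic bubble function on the reference triangle. -/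
def bubble : C(refTriangle, ℝ) := (nodal 0 * nodal 1 * nodal 2).restrict refTriangle

/-- The internal (bubble) space: the span of the `b * v` with `v ∈ P_{m-3}`; it is zero for
`m < 3`. -/
def internalSpace (m : ℕ) : Submodule ℝ C(refTriangle, ℝ) :=
  Submodule.span ℝ {u | 3 ≤ m ∧ ∃ v ∈ polySpace refTriangle (m - 3), u = bubble * v}

/-- `m̂ = (m-1)(m-2)/2`. -/
def bubbleDim (m : ℕ) : ℕ := (m - 1) * (m - 2) / 2

/-- The points `x` are Fekete points for the functions `g`: they maximise the absolute value of
the Vandermonde determinant over all choices of points. -/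
def IsFekete {X : Type*} [TopologicalSpace X] {N : ℕ} (g : Fin N → C(X, ℝ)) (x : Fin N → X) :
    Prop :=
  ∀ y : Fin N → X,
    |(Matrix.of fun i j => g j (y i)).det| ≤ |(Matrix.of fun i j => g j (x i)).det|

/-- The points `x` are the Fekete points of order `m` on the face `i`, i.e. Fekete points for
a basis of `P_m` of the face. (Changing the basis multiplies all determinants by one nonzero
constant.) -/
def IsFaceFekete {m : ℕ} {i : Fin 3} (x : Fin (m + 1) → face i) : Prop :=
  ∃ g : Module.Basis (Fin (m + 1)) ℝ (polySpace (face i) m),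
    IsFekete (fun j => (g j : C(face i, ℝ))) x

/-- The points `x` are the `m + 1` Gauss–Lobatto points of the face `i`: with the face
parametrised affinely by `[0,1]`, the end points together with the zeros of the derivative of the
Legendre polynomial of degree `m`. -/
def IsFaceGaussLobatto {m : ℕ} {i : Fin 3} (x : Fin (m + 1) → face i) : Prop :=
  Function.Injective x ∧
    Set.range (fun j => (x j : ℝ × ℝ)) =
      (AffineMap.lineMap (vertex (i + 1)) (vertex (i + 2)) : ℝ →ᵃ[ℝ] ℝ × ℝ) ''
        ({0, 1} ∪ {t : ℝ | aeval t (derivative (shiftedLegendre m)) = 0})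

/-- The combination of the nodal and side shape functions on the face `i` with nodal values taken
from `f` and side coefficients `c`; `c k` is the coefficient of the side function of degree
`k + 2`, for `2 ≤ k + 2 ≤ m`. -/
def externalComb (Φ : ℕ → ℝ[X]) {m : ℕ} {i : Fin 3} (f : C(face i, ℝ)) (c : Fin (m - 1) → ℝ) :
    C(face i, ℝ) :=
  ((∑ k : Fin (m - 1), c k • sideShape Φ i k) + f (faceLeft i) • nodal (i + 1)
    + f (faceRight i) • nodal (i + 2)).restrict (face i)

/-- `c` are the coefficients of the external interpolant `E f` on the face `i` at the nodes `x`. -/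
def IsExternalInterp (Φ : ℕ → ℝ[X]) {m : ℕ} {i : Fin 3} (x : Fin (m + 1) → face i)
    (f : C(face i, ℝ)) (c : Fin (m - 1) → ℝ) : Prop :=
  ∀ j, externalComb Φ f c (x j) = f (x j)

/-- The combination of the internal basis functions with coefficients `a`. -/
def internalComb {m : ℕ} (B : Module.Basis (Fin (bubbleDim m)) ℝ (internalSpace m))
    (a : Fin (bubbleDim m) → ℝ) : C(refTriangle, ℝ) :=
  ∑ k, a k • (B k : C(refTriangle, ℝ))

/-- `a` are the coefficients of the internal interpolant `I f` at the nodes `z`. -/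
def IsInternalInterp {m : ℕ} (B : Module.Basis (Fin (bubbleDim m)) ℝ (internalSpace m))
    (z : Fin (bubbleDim m) → refTriangle) (f : C(refTriangle, ℝ))
    (a : Fin (bubbleDim m) → ℝ) : Prop :=
  ∀ j, internalComb B a (z j) = f (z j)

end HPInterp

end

/-! Internal interpolation: by Cramer's rule, the value at `p` of a Lagrange function for Fekete
points is a quotient of two collocation determinants, the numerator having one node replaced by `p`.
Maximality bounds it by 1, and summing over the nodes gives the factor `bubbleDim m`. Linear
independence makes the maximal determinant nonzero (`IsFekete.existsUnique_and_norm_le`).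

External interpolation: in the affine coordinate of a face, the side functions and the two nodal
functions span the polynomials of degree at most `m`. Hence `E` is Lagrange interpolation whatever
the `Φ k` are, and its norm is bounded by the Lebesgue constant of the nodes.

The two descriptions of the nodes agree by Fejér's argument. At an interior Fekete node the Lagrange
function has a local maximum, so the nodal polynomial `ω` has `ω'' = 0` there, and `x(x-1)ω'' =
m(m+1)ω` follows by counting zeros. Polynomial solutions of this equation are unique up to a factor,
and `x(x-1)P'`, with `P` the shifted Legendre polynomial, is one.

For the logarithm, put `x = (1 - cos θ)/2`. Then `w = sin^{3/2} θ · P'(x)` solves `w'' + (μ² - 3/(4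
sin² θ)) w = 0` with `μ = m + 1/2`. Sturm comparison separates its zeros by at least `π/μ`; Sonin's
monotone quantities bound `|w|` by `4|w'(φ)|/μ` at any interior zero `φ` (`pi_div_le_sub`,
`abs_le_of_zero`). So an interior Lagrange function is at most `2π/μ` divided by the angular
distance to its node, and is also at most 1. Summing over separated angles gives a harmonic sum. -/

namespace HPInterp

/-! ### Fekete points and bounded Lagrange functions -/

open Matrix

/-- Linearly independent functions have a nonsingular collocation matrix at suitable points. -/
theorem exists_det_collocation_ne_zero {X : Type*} {N : ℕ} {g : Fin N → X → ℝ}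
    (hg : LinearIndependent ℝ g) :
    ∃ y : Fin N → X, (Matrix.of fun i j => g j (y i)).det ≠ 0 := by
  have htop : Submodule.span ℝ (Set.range fun (p : X) (j : Fin N) => g j p) = ⊤ := by
    -- Otherwise a nonzero functional kills every evaluation vector, and its coordinates are a
    -- linear relation among the `g j`.
    by_contra hne
    obtain ⟨φ, hφ, hle⟩ := Submodule.exists_le_ker_of_lt_top _ (lt_top_iff_ne_top.mpr hne)
    have hφ' : ∀ v : Fin N → ℝ, φ v = ∑ j, φ (Pi.single j 1) * v j := fun v => by
      conv_lhs => rw [← Finset.univ_sum_single v]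
      rw [map_sum]
      refine Finset.sum_congr rfl fun j _ => ?_
      have h : (Pi.single j (v j) : Fin N → ℝ) = v j • Pi.single j 1 := by
        rw [← Pi.single_smul]; simp
      rw [h, map_smul, smul_eq_mul, mul_comm]
    have hz : ∑ j, φ (Pi.single j 1) • g j = 0 := by
      funext p
      have h : φ (fun j => g j p) = 0 := hle (Submodule.subset_span ⟨p, rfl⟩)
      rw [hφ'] at h
      simpa using h
    have h0 := Fintype.linearIndependent_iff.mp hg _ hz
    exact hφ (LinearMap.ext fun v => by rw [hφ' v]; simp [h0])
  have hfr : Module.finrank ℝ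
      (Submodule.span ℝ (Set.range fun (p : X) (j : Fin N) => g j p)) = N := by
    rw [htop, finrank_top, Module.finrank_fin_fun]
  obtain ⟨f, hf, -, hli⟩ := Submodule.exists_fun_fin_finrank_span_eq ℝ
    (Set.range fun (p : X) (j : Fin N) => g j p)
  choose y hy using hf
  refine ⟨fun i => y (Fin.cast hfr.symm i), ?_⟩
  have hrows : LinearIndependent ℝ
      (Matrix.of fun i j => g j (y (Fin.cast hfr.symm i))).row := by
    have : (Matrix.of fun i j => g j (y (Fin.cast hfr.symm i))).row
        = f ∘ Fin.cast hfr.symm := by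
      funext i j
      exact congrFun (hy _) j
    rw [this]
    exact hli.comp _ (Fin.cast_injective _)
  exact ((Matrix.isUnit_iff_isUnit_det _).mp
    (Matrix.linearIndependent_rows_iff_isUnit.mp hrows)).ne_zero

theorem IsFekete.det_ne_zero {X : Type*} [TopologicalSpace X] {N : ℕ} {g : Fin N → C(X, ℝ)}
    {x : Fin N → X} (h : IsFekete g x) (hg : LinearIndependent ℝ g) :
    (Matrix.of fun i j => g j (x i)).det ≠ 0 := by
  have hg' : LinearIndependent ℝ fun j => (g j : X → ℝ) :=
    hg.map' (ContinuousMap.coeFnLinearMap ℝ) (LinearMap.ker_eq_bot.mpr DFunLike.coe_injective)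
  obtain ⟨y, hy⟩ := exists_det_collocation_ne_zero hg'
  exact abs_pos.mp ((abs_pos.mpr hy).trans_le (h y))

/-- If replacing any row of a nonsingular matrix by `b` does not increase the absolute value of the
determinant, then `b` is a combination of the rows with coefficients in `[-1, 1]`. -/
theorem exists_vecMul_eq_of_abs_det_updateRow_le {n : Type*} [Fintype n] [DecidableEq n]
    {A : Matrix n n ℝ} (hA : A.det ≠ 0) {b : n → ℝ}
    (hb : ∀ j, |(A.updateRow j b).det| ≤ |A.det|) :
    ∃ ℓ : n → ℝ, (∀ j, |ℓ j| ≤ 1) ∧ ℓ ᵥ* A = b := by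
  have hu : IsUnit A.det := hA.isUnit
  refine ⟨b ᵥ* A⁻¹, fun j => ?_, ?_⟩
  · have hrow : ∑ k, (b ᵥ* A⁻¹) k • A k = b := by
      rw [← Matrix.vecMul_eq_sum, Matrix.vecMul_vecMul, Matrix.nonsing_inv_mul _ hu,
        Matrix.vecMul_one]
    have h := Matrix.det_updateRow_sum A j (b ᵥ* A⁻¹)
    rw [hrow] at h
    have h2 := hb j
    rw [h, smul_eq_mul, abs_mul] at h2
    exact le_of_mul_le_mul_right (by simpa using h2) (abs_pos.mpr hA)
  · rw [Matrix.vecMul_vecMul, Matrix.nonsing_inv_mul _ hu, Matrix.vecMul_one]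

/-- The nodes with `x j` replaced by `p` compete in the maximisation, and their matrix is the old
one with row `j` replaced. The `ℓ j` are the values at `p` of the Lagrange functions. -/
theorem IsFekete.exists_cardinal {X : Type*} [TopologicalSpace X] {N : ℕ} {g : Fin N → C(X, ℝ)}
    {x : Fin N → X} (h : IsFekete g x) (hg : LinearIndependent ℝ g) (p : X) :
    ∃ ℓ : Fin N → ℝ, (∀ j, |ℓ j| ≤ 1) ∧ ∀ k, g k p = ∑ j, ℓ j * g k (x j) := by
  obtain ⟨ℓ, h1, h2⟩ := exists_vecMul_eq_of_abs_det_updateRow_le (h.det_ne_zero hg)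
    (b := fun k => g k p) fun j => by
      convert h (Function.update x j p) using 3
      ext i k
      by_cases hij : i = j
      · subst hij; simp
      · simp [hij]
  exact ⟨ℓ, h1, fun k => (congrFun h2 k).symm⟩

theorem IsFekete.existsUnique_and_norm_le {X : Type*} [TopologicalSpace X] [CompactSpace X] {N : ℕ}
    {g : Fin N → C(X, ℝ)} {x : Fin N → X} (h : IsFekete g x) (hg : LinearIndependent ℝ g)
    (f : C(X, ℝ)) :
    (∃! a : Fin N → ℝ, ∀ j, (∑ k, a k • g k) (x j) = f (x j)) ∧
      ∀ a : Fin N → ℝ, (∀ j, (∑ k, a k • g k) (x j) = f (x j)) →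
        ‖∑ k, a k • g k‖ ≤ N * ‖f‖ := by
  have happ : ∀ (a : Fin N → ℝ) (p : X), (∑ k, a k • g k) p = ∑ k, a k * g k p := fun a p => by
    simp [ContinuousMap.sum_apply]
  have hmul : ∀ a : Fin N → ℝ, (∀ j, (∑ k, a k • g k) (x j) = f (x j)) ↔
      (Matrix.of fun i j => g j (x i)) *ᵥ a = fun j => f (x j) := fun a => by
    rw [funext_iff]
    refine forall_congr' fun j => ?_
    rw [happ]
    simp [Matrix.mulVec, dotProduct, mul_comm]
  have hu : IsUnit (Matrix.of fun i j => g j (x i)) :=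
    (Matrix.isUnit_iff_isUnit_det _).mpr (h.det_ne_zero hg).isUnit
  constructor
  · simp_rw [hmul]
    exact (Function.bijective_iff_existsUnique _).mp
      ⟨Matrix.mulVec_injective_iff_isUnit.mpr hu, Matrix.mulVec_surjective_iff_isUnit.mpr hu⟩ _
  · intro a ha
    refine (ContinuousMap.norm_le _ (by positivity)).mpr fun p => ?_
    obtain ⟨ℓ, h1, h2⟩ := h.exists_cardinal hg p
    have : (∑ k, a k • g k) p = ∑ j, ℓ j * f (x j) := by
      rw [happ]
      simp_rw [← ha, happ, h2, Finset.mul_sum]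
      rw [Finset.sum_comm]
      exact Finset.sum_congr rfl fun j _ => Finset.sum_congr rfl fun k _ => by ring
    rw [this]
    calc ‖∑ j, ℓ j * f (x j)‖ ≤ ∑ j : Fin N, ‖f‖ := by
          refine (norm_sum_le _ _).trans (Finset.sum_le_sum fun j _ => ?_)
          rw [norm_mul]
          exact (mul_le_mul (h1 j) (f.norm_coe_le_norm _) (norm_nonneg _) zero_le_one).trans_eq
            (one_mul _)
      _ = N * ‖f‖ := by simp

end HPInterp

/-! ### Fejér's theorem: Fekete points of an interval are Gauss–Lobatto points -/

namespace HPInterp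

open Polynomial Matrix

/-- Points of `[0, 1]` maximising the Vandermonde determinant. -/
structure IsVandermondeFekete {n : ℕ} (t : Fin n → ℝ) : Prop where
  mem : ∀ j, t j ∈ Set.Icc (0 : ℝ) 1
  le : ∀ y : Fin n → ℝ, (∀ j, y j ∈ Set.Icc (0 : ℝ) 1) →
    |(vandermonde y).det| ≤ |(vandermonde t).det|

theorem exists_isVandermondeFekete (n : ℕ) : ∃ t : Fin n → ℝ, IsVandermondeFekete t := by
  have hc : IsCompact (Set.univ.pi fun _ : Fin n => Set.Icc (0 : ℝ) 1) :=
    isCompact_univ_pi fun _ => isCompact_Icc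
  have hcont : Continuous fun y : Fin n → ℝ => |(vandermonde y).det| := by
    refine (Continuous.matrix_det ?_).abs
    exact continuous_matrix fun i j => (continuous_apply i).pow _
  obtain ⟨t, ht, hmax⟩ := hc.exists_isMaxOn ⟨fun _ => 0, fun _ _ => by simp⟩ hcont.continuousOn
  exact ⟨t, fun j => ht j trivial, fun y hy => hmax (fun j _ => hy j)⟩

namespace IsVandermondeFekete

variable {n : ℕ} {t : Fin n → ℝ}

theorem injective (h : IsVandermondeFekete t) : Function.Injective t := by
  rw [← det_vandermonde_ne_zero_iff, ← abs_pos]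
  -- Any distinct nodes have a nonzero determinant; the points `j / n` are compared with the
  -- maximiser.
  refine lt_of_lt_of_le ?_ (h.le (fun j => (j : ℝ) / n) fun j => ⟨by positivity, ?_⟩)
  · rw [abs_pos, det_vandermonde_ne_zero_iff]
    intro a b hab
    have hn : (n : ℝ) ≠ 0 := by
      have := a.pos
      positivity
    simp only at hab
    rw [div_left_inj' hn] at hab
    exact Fin.ext (by exact_mod_cast hab)
  · exact div_le_one_of_le₀ (by exact_mod_cast j.isLt.le) (by positivity)

theorem abs_eval_basis_le (h : IsVandermondeFekete t) (j : Fin n) {τ : ℝ}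
    (hτ : τ ∈ Set.Icc (0 : ℝ) 1) : |(Lagrange.basis Finset.univ t j).eval τ| ≤ 1 := by
  obtain ⟨ℓ, h1, h2⟩ := exists_vecMul_eq_of_abs_det_updateRow_le
    (det_vandermonde_ne_zero_iff.mpr h.injective) (b := fun k : Fin n => τ ^ (k : ℕ)) fun j => by
      have hupd : (vandermonde t).updateRow j (fun k : Fin n => τ ^ (k : ℕ))
          = vandermonde (Function.update t j τ) := by
        ext i k
        by_cases hij : i = j
        · subst hij; simp [vandermonde_apply]
        · simp [hij, vandermonde_apply]
      rw [hupd]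
      refine h.le _ fun i => ?_
      by_cases hij : i = j
      · subst hij; simpa using hτ
      · simpa [hij] using h.mem i
  have hpow : ∀ k < n, τ ^ k = ∑ i, ℓ i * t i ^ k := fun k hk =>
    (congrFun h2 ⟨k, hk⟩).symm
  have hdeg : (Lagrange.basis Finset.univ t j).natDegree < n := by
    rw [Lagrange.natDegree_basis h.injective.injOn (Finset.mem_univ j), Finset.card_fin]
    have := j.pos
    omega
  -- The `ℓ i` reproduce the value at `τ` of every polynomial of degree less than `n`; on the
  -- Lagrange polynomial only the term `j` survives.
  have : (Lagrange.basis Finset.univ t j).eval τ = ℓ j := by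
    have hsum : (Lagrange.basis Finset.univ t j).eval τ
        = ∑ i, ℓ i * (Lagrange.basis Finset.univ t j).eval (t i) := by
      simp_rw [eval_eq_sum_range' hdeg, Finset.mul_sum]
      rw [Finset.sum_comm]
      refine Finset.sum_congr rfl fun k hk => ?_
      rw [hpow k (Finset.mem_range.mp hk), Finset.mul_sum]
      exact Finset.sum_congr rfl fun i _ => by ring
    rw [hsum, Finset.sum_eq_single j]
    · rw [Lagrange.eval_basis_self h.injective.injOn (Finset.mem_univ j), mul_one]
    · intro i _ hij
      rw [Lagrange.eval_basis_of_ne hij.symm (Finset.mem_univ i), mul_zero]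
    · simp
  rw [this]
  exact h1 j

/-- Write `ω = (x - t j) g`, so that `ω''(t j) = 2 g'(t j)`. Here `g` is a multiple of the Lagrange
polynomial, which is at most 1 on the interval and equals 1 at `t j`, an interior maximum. -/
theorem eval_derivative_derivative_nodal (h : IsVandermondeFekete t) {j : Fin n}
    (hj : t j ∈ Set.Ioo (0 : ℝ) 1) :
    (derivative (derivative (Lagrange.nodal Finset.univ t))).eval (t j) = 0 := by
  have hbasis : Lagrange.basis Finset.univ t j
      = C (Lagrange.nodalWeight Finset.univ t j) *
        Lagrange.nodal (Finset.univ.erase j) t := by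
    rw [Lagrange.basis_eq_prod_sub_inv_mul_nodal_div (Finset.mem_univ j),
      Lagrange.nodal_erase_eq_nodal_div (Finset.mem_univ j)]
  have hmax : IsLocalMax (fun τ => (Lagrange.basis Finset.univ t j).eval τ) (t j) := by
    filter_upwards [Icc_mem_nhds hj.1 hj.2] with τ hτ
    rw [Lagrange.eval_basis_self h.injective.injOn (Finset.mem_univ j)]
    exact (abs_le.mp (h.abs_eval_basis_le j hτ)).2
  have hd := hmax.hasDerivAt_eq_zero (Polynomial.hasDerivAt _ _)
  rw [hbasis, derivative_C_mul, eval_mul, eval_C] at hd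
  have hN := (mul_eq_zero.mp hd).resolve_left
    (Lagrange.nodalWeight_ne_zero h.injective.injOn (Finset.mem_univ j))
  rw [Lagrange.nodal_eq_mul_nodal_erase (Finset.mem_univ j)]
  simp [derivative_mul, hN]

end IsVandermondeFekete

theorem coeff_X_mul_X_sub_one_mul (p : ℝ[X]) (k : ℕ) :
    (X * (X - 1) * derivative (derivative p)).coeff k
      = k * (k - 1) * p.coeff k - (k + 1) * k * p.coeff (k + 1) := by
  have : X * (X - 1) * derivative (derivative p)
      = derivative (derivative p) * X * X - derivative (derivative p) * X := by ring
  rw [this, coeff_sub]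
  rcases k with _ | _ | k
  · simp
  · simp [coeff_derivative, mul_comm]
  · simp only [coeff_mul_X, coeff_derivative]
    push_cast
    ring

/-- At the singular point 0 the coefficient recurrence forces `p.coeff 0 = 0` and leaves `p.coeff 1`
as the only free parameter. -/
theorem eq_zero_of_lobatto_ode {lam : ℝ} (hlam : lam ≠ 0) {p : ℝ[X]}
    (hp : X * (X - 1) * derivative (derivative p) = C lam * p) (h1 : p.coeff 1 = 0) : p = 0 := by
  have hrec : ∀ k : ℕ, (k * (k - 1) - lam) * p.coeff k = (k + 1) * k * p.coeff (k + 1) := by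
    intro k
    have h := congrArg (fun r => r.coeff k) hp
    simp only [coeff_X_mul_X_sub_one_mul, coeff_C_mul] at h
    linarith
  have h0 : p.coeff 0 = 0 := by
    have := hrec 0
    simpa [hlam] using this
  ext k
  rw [coeff_zero]
  induction k with
  | zero => exact h0
  | succ k ih =>
    rcases k with _ | k
    · exact h1
    · have h := hrec (k + 1)
      rw [ih, mul_zero] at h
      have hk : ((k + 1 : ℕ) + 1 : ℝ) * (k + 1 : ℕ) ≠ 0 := by positivity
      exact (mul_eq_zero.mp h.symm).resolve_left hk

/-- The coefficients of degree `m + 1` cancel, so the difference has degree at most `m`, and it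
vanishes at `m + 1` nodes. The factor `X * (X - 1)` takes care of nodes at 0 or 1, without knowing
whether these are nodes. -/
theorem IsVandermondeFekete.nodal_ode {m : ℕ} {t : Fin (m + 1) → ℝ}
    (h : IsVandermondeFekete t) :
    X * (X - 1) * derivative (derivative (Lagrange.nodal Finset.univ t))
      = C ((m : ℝ) * (m + 1)) * Lagrange.nodal Finset.univ t := by
  have hdeg : (Lagrange.nodal Finset.univ t).natDegree = m + 1 := by
    rw [Lagrange.natDegree_nodal]; simp
  refine Polynomial.eq_of_degree_sub_lt_of_eval_index_eq Finset.univ h.injective.injOn ?_ ?_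
  · rw [Finset.card_fin, degree_lt_iff_coeff_zero]
    intro k hk
    rw [coeff_sub, coeff_X_mul_X_sub_one_mul, coeff_C_mul]
    rw [coeff_eq_zero_of_natDegree_lt (p := Lagrange.nodal Finset.univ t) (n := k + 1) (by omega)]
    rcases eq_or_lt_of_le hk with rfl | hk
    · push_cast; ring
    · rw [coeff_eq_zero_of_natDegree_lt (by omega)]
      ring
  · intro j _
    rw [eval_mul, eval_mul, eval_mul, Lagrange.eval_nodal_at_node (Finset.mem_univ j), mul_zero]
    by_cases h0 : t j = 0
    · simp [h0]
    by_cases h1 : t j = 1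
    · simp [h1]
    · have hj := h.mem j
      rw [h.eval_derivative_derivative_nodal
        ⟨lt_of_le_of_ne hj.1 (Ne.symm h0), lt_of_le_of_ne hj.2 h1⟩, mul_zero]

/-- The shifted Legendre polynomial with real coefficients. -/
noncomputable def legendre (m : ℕ) : ℝ[X] := (shiftedLegendre m).map (Int.castRingHom ℝ)

theorem coeff_legendre_succ (m k : ℕ) :
    (k + 1 : ℝ) ^ 2 * (legendre m).coeff (k + 1)
      = (k * (k + 1) - m * (m + 1)) * (legendre m).coeff k := by
  simp only [legendre, coeff_map, coeff_shiftedLegendre, eq_intCast]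
  push_cast
  have h1 : (m.choose (k + 1) : ℝ) * (k + 1) = m.choose k * (m - k) := by
    rcases le_or_gt k m with hk | hk
    · have := Nat.choose_succ_right_eq m k
      rw [← Nat.cast_sub hk]
      exact_mod_cast this
    · simp [Nat.choose_eq_zero_of_lt hk, Nat.choose_eq_zero_of_lt (hk.trans k.lt_succ_self)]
  have h2 : ((m + (k + 1)).choose m : ℝ) * (k + 1) = (m + k + 1) * (m + k).choose m := by
    have h := Nat.add_one_mul_choose_eq (m + k) k
    rw [Nat.choose_symm_of_eq_add (show m + (k + 1) = m + (k + 1) from rfl),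
      Nat.choose_symm_of_eq_add (show m + k = m + k from rfl)]
    exact_mod_cast h.symm
  rw [pow_succ (-1 : ℝ) k]
  linear_combination (-(-1) ^ k * (k + 1) * ((m + (k + 1)).choose m : ℝ)) * h1
    - (-1) ^ k * (m.choose k : ℝ) * (m - k) * h2

theorem legendre_ode (m : ℕ) :
    X * (X - 1) * derivative (derivative (legendre m)) + (2 * X - 1) * derivative (legendre m)
      = C ((m : ℝ) * (m + 1)) * legendre m := by
  ext k
  have hrec := coeff_legendre_succ m k
  have : (2 * X - 1) * derivative (legendre m)
      = C 2 * (derivative (legendre m) * X) - derivative (legendre m) := by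
    rw [map_ofNat]; ring
  rw [coeff_add, coeff_X_mul_X_sub_one_mul, this, coeff_sub, coeff_C_mul, coeff_C_mul]
  rcases k with _ | k
  · simp only [coeff_mul_X_zero, coeff_derivative] at *
    push_cast at *
    linarith
  · simp only [coeff_mul_X, coeff_derivative]
    push_cast at *
    linarith

/-- The polynomial of degree `m + 1` whose zeros are the Gauss–Lobatto points of `[0, 1]`. -/
noncomputable def lobatto (m : ℕ) : ℝ[X] := X * (X - 1) * derivative (legendre m)

/-- Self-adjoint form of Legendre's equation. Differentiating once more gives `lobatto_ode`, the
equation of the nodal polynomial. -/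
theorem derivative_lobatto (m : ℕ) :
    derivative (lobatto m) = C ((m : ℝ) * (m + 1)) * legendre m := by
  rw [← legendre_ode, lobatto]
  simp only [derivative_mul, derivative_sub, derivative_X, derivative_one]
  ring

theorem lobatto_ode (m : ℕ) :
    X * (X - 1) * derivative (derivative (lobatto m)) = C ((m : ℝ) * (m + 1)) * lobatto m := by
  rw [derivative_lobatto, derivative_C_mul, lobatto]
  ring

theorem lobatto_ne_zero {m : ℕ} (hm : 1 ≤ m) : lobatto m ≠ 0 := by
  intro h
  have h1 := derivative_lobatto m
  rw [h, derivative_zero] at h1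
  have h2 : (legendre m).coeff 0 = 1 := by
    simp [legendre, coeff_shiftedLegendre]
  have h3 := congrArg (fun r => r.coeff 0) h1
  simp only [coeff_zero, coeff_C_mul, h2] at h3
  have : (0 : ℝ) < (m : ℝ) * (m + 1) := by positivity
  linarith

/-- Both polynomials solve the same equation, and the combination that cancels their linear
coefficients is zero by `eq_zero_of_lobatto_ode`. -/
theorem IsVandermondeFekete.exists_nodal_eq {m : ℕ} (hm : 1 ≤ m) {t : Fin (m + 1) → ℝ}
    (h : IsVandermondeFekete t) :
    ∃ κ : ℝ, κ ≠ 0 ∧ lobatto m = C κ * Lagrange.nodal Finset.univ t := by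
  set ω := Lagrange.nodal Finset.univ t with hω
  have hlam : (m : ℝ) * (m + 1) ≠ 0 := by positivity
  have hω1 : ω.coeff 1 ≠ 0 := fun h1 =>
    Lagrange.nodal_ne_zero (eq_zero_of_lobatto_ode hlam (h.nodal_ode) h1)
  have hdiff : C (ω.coeff 1) * lobatto m - C ((lobatto m).coeff 1) * ω = 0 := by
    refine eq_zero_of_lobatto_ode hlam ?_ ?_
    · have e1 := lobatto_ode m
      have e2 := h.nodal_ode
      rw [← hω] at e2
      simp only [derivative_sub, derivative_C_mul]
      linear_combination C (ω.coeff 1) * e1 - C ((lobatto m).coeff 1) * e2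
    · simp [mul_comm]
  have heq : lobatto m = C ((lobatto m).coeff 1 / ω.coeff 1) * ω := by
    have hC : C (ω.coeff 1)⁻¹ * C (ω.coeff 1) = 1 := by
      rw [← C_mul, inv_mul_cancel₀ hω1, C_1]
    rw [div_eq_mul_inv, C_mul]
    linear_combination (-lobatto m) * hC + C (ω.coeff 1)⁻¹ * hdiff
  refine ⟨_, fun h0 => lobatto_ne_zero hm ?_, heq⟩
  rw [heq, h0, C_0, zero_mul]

theorem IsVandermondeFekete.range_eq {m : ℕ} (hm : 1 ≤ m) {t : Fin (m + 1) → ℝ}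
    (h : IsVandermondeFekete t) : Set.range t = {τ | (lobatto m).eval τ = 0} := by
  obtain ⟨κ, hκ, heq⟩ := h.exists_nodal_eq hm
  ext τ
  rw [Set.mem_ofPred_eq, heq, eval_mul, eval_C, Lagrange.eval_nodal]
  simp only [mul_eq_zero, hκ, false_or, Finset.prod_eq_zero_iff, Finset.mem_univ, true_and,
    sub_eq_zero, Set.mem_range]
  exact exists_congr fun j => eq_comm

/-- Gauss–Lobatto points are Fekete points. -/
theorem isVandermondeFekete_of_range_eq {m : ℕ} (hm : 1 ≤ m) {t : Fin (m + 1) → ℝ}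
    (ht : Function.Injective t) (hr : Set.range t = {τ | (lobatto m).eval τ = 0}) :
    IsVandermondeFekete t := by
  -- A maximiser exists by compactness and has the same zero set as range, so `t` is a permutation
  -- of it and the determinants agree up to sign.
  obtain ⟨t', h'⟩ := exists_isVandermondeFekete (m + 1)
  have hrange : Set.range t = Set.range t' := hr.trans (h'.range_eq hm).symm
  have hex : ∀ j, ∃ k, t' k = t j := fun j => by
    have : t j ∈ Set.range t' := hrange ▸ Set.mem_range_self j
    exact this
  choose σ hσ using hex
  have hσi : Function.Injective σ := fun a b hab => ht (by rw [← hσ a, ← hσ b, hab])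
  let e := Equiv.ofBijective σ (Finite.injective_iff_bijective.mp hσi)
  have hV : vandermonde t = (vandermonde t').submatrix e id := by
    ext i k
    simp [vandermonde_apply, e, hσ]
  have hdet : |(vandermonde t).det| = |(vandermonde t').det| := by
    rw [hV, det_permute, abs_mul]
    rcases Int.units_eq_one_or (Equiv.Perm.sign e) with h | h <;> simp [h]
  exact ⟨fun j => hσ j ▸ h'.mem _, fun y hy => (h'.le y hy).trans_eq hdet.symm⟩

end HPInterp

/-! ### Sturm comparison and Sonin estimates for the angular equation -/

namespace HPInterp

open Real

/-- The potential of the Liouville normal form of the Lobatto equation in the angular variable. -/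
noncomputable def potential (μ θ : ℝ) : ℝ := μ ^ 2 - 3 / (4 * sin θ ^ 2)

/-- Nontrivial solutions `w` of `w'' + Q w = 0` on `(0, π)`, where `Q` is the potential, which
vanish at `0` and `π`; `w'` is recorded as `w₁`. -/
structure IsAngularSolution (μ : ℝ) (w w₁ : ℝ → ℝ) : Prop where
  continuous : Continuous w
  continuous' : Continuous w₁
  hasDerivAt : ∀ θ ∈ Set.Ioo 0 π, HasDerivAt w (w₁ θ) θ
  hasDerivAt' : ∀ θ ∈ Set.Ioo 0 π, HasDerivAt w₁ (-potential μ θ * w θ) θ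
  zero : w 0 = 0
  pi : w π = 0
  nontrivial : ∀ a b, 0 ≤ a → a < b → b ≤ π → ∃ θ ∈ Set.Ioo a b, w θ ≠ 0

theorem potential_pi_sub (μ θ : ℝ) : potential μ (π - θ) = potential μ θ := by
  simp [potential]

theorem hasDerivAt_potential (μ : ℝ) {θ : ℝ} (hθ : θ ∈ Set.Ioo 0 π) :
    HasDerivAt (potential μ) (3 / 2 * cos θ / sin θ ^ 3) θ := by
  have hs : sin θ ≠ 0 := (sin_pos_of_mem_Ioo hθ).ne'
  have h : HasDerivAt (fun x => μ ^ 2 - 3 / (4 * sin x ^ 2))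
      (0 - (0 * (4 * sin θ ^ 2) - 3 * (4 * ((2 : ℕ) * sin θ ^ (2 - 1) * cos θ)))
        / (4 * sin θ ^ 2) ^ 2) θ :=
    (hasDerivAt_const θ (μ ^ 2)).fun_sub
      ((hasDerivAt_const θ (3 : ℝ)).fun_div (((hasDerivAt_sin θ).fun_pow 2).const_mul 4)
        (by positivity))
  refine h.congr_deriv ?_
  field_simp
  norm_num
  ring

theorem potential_lt (μ : ℝ) {θ : ℝ} (hθ : θ ∈ Set.Ioo 0 π) : potential μ θ < μ ^ 2 := by
  have hs : 0 < sin θ := sin_pos_of_mem_Ioo hθ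
  have : 0 < 3 / (4 * sin θ ^ 2) := by positivity
  unfold potential
  linarith

theorem potential_mono (μ : ℝ) {x y : ℝ} (hx : 0 < x) (hxy : x ≤ y) (hy : y ≤ π / 2) :
    potential μ x ≤ potential μ y := by
  have hs : 0 < sin x := sin_pos_of_pos_of_lt_pi hx (by linarith [pi_pos])
  have hle : sin x ≤ sin y := sin_le_sin_of_le_of_le_pi_div_two (by linarith) hy hxy
  unfold potential
  gcongr

/-- Jordan's inequality gives `sin (π / (2 * μ)) ≥ 1 / μ`. From this angle up to `π / 2` the
potential lies between `μ ^ 2 / 4` and `μ ^ 2`. -/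
theorem sq_div_four_le_potential {μ : ℝ} (hμ : 1 ≤ μ) :
    μ ^ 2 / 4 ≤ potential μ (π / (2 * μ)) := by
  have hpi := pi_pos
  have h := mul_le_sin (x := π / (2 * μ)) (by positivity) (by
    gcongr; linarith)
  have h1 : 2 / π * (π / (2 * μ)) = 1 / μ := by field_simp
  rw [h1] at h
  have h2 : 3 / (4 * sin (π / (2 * μ)) ^ 2) ≤ 3 / (4 * (1 / μ) ^ 2) := by gcongr
  have h3 : 3 / (4 * (1 / μ) ^ 2) = 3 / 4 * μ ^ 2 := by field_simp
  unfold potential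
  linarith

namespace IsAngularSolution

variable {μ : ℝ} {w w₁ : ℝ → ℝ}

theorem reflect (h : IsAngularSolution μ w w₁) :
    IsAngularSolution μ (fun θ => w (π - θ)) (fun θ => -w₁ (π - θ)) where
  continuous := h.continuous.comp (by fun_prop)
  continuous' := (h.continuous'.comp (by fun_prop)).neg
  hasDerivAt θ hθ := by
    have := (h.hasDerivAt (π - θ) ⟨by linarith [hθ.2], by linarith [hθ.1]⟩).comp_const_sub π θ
    exact this
  hasDerivAt' θ hθ := by
    have := ((h.hasDerivAt' (π - θ) ⟨by linarith [hθ.2], by linarith [hθ.1]⟩).comp_const_sub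
      π θ).neg
    refine this.congr_deriv ?_
    rw [potential_pi_sub]
    ring
  zero := by simp [h.pi]
  pi := by simp [h.zero]
  nontrivial a b ha hab hb := by
    obtain ⟨θ, hθ, hw⟩ := h.nontrivial (π - b) (π - a) (by linarith) (by linarith) (by linarith)
    exact ⟨π - θ, ⟨by linarith [hθ.2], by linarith [hθ.1]⟩, by simpa using hw⟩

/-- Picone's identity for `w` against `v = sin (μ (x - d))`, which solves `v'' + μ² v = 0`: the
function is `w w' - w² v'/v`. -/
theorem hasDerivAt_picone (h : IsAngularSolution μ w w₁) (d : ℝ) {θ : ℝ} (hθ : θ ∈ Set.Ioo 0 π)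
    (hs : sin (μ * (θ - d)) ≠ 0) :
    HasDerivAt (fun x => w x * w₁ x - μ * w x ^ 2 * (cos (μ * (x - d)) / sin (μ * (x - d))))
      ((w₁ θ - μ * w θ * (cos (μ * (θ - d)) / sin (μ * (θ - d)))) ^ 2
        + (μ ^ 2 - potential μ θ) * w θ ^ 2) θ := by
  have hl : HasDerivAt (fun x => μ * (x - d)) (μ * 1) θ :=
    ((hasDerivAt_id θ).sub_const d).const_mul μ
  have hd := ((h.hasDerivAt θ hθ).fun_mul (h.hasDerivAt' θ hθ)).fun_sub
    ((((h.hasDerivAt θ hθ).fun_pow 2).const_mul μ).fun_mul (hl.cos.fun_div hl.sin hs))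
  refine hd.congr_deriv ?_
  have hcs := sin_sq_add_cos_sq (μ * (θ - d))
  have h1 : (-sin (μ * (θ - d)) * (μ * 1) * sin (μ * (θ - d))
      - cos (μ * (θ - d)) * (cos (μ * (θ - d)) * (μ * 1))) / sin (μ * (θ - d)) ^ 2
      = -μ * (1 + (cos (μ * (θ - d)) / sin (μ * (θ - d))) ^ 2) := by
    field_simp
    ring
  rw [h1]
  norm_num
  ring

/-- The phase shift `ε` keeps the comparison sine positive on the closed interval, including its
left end, so the cotangent has no pole there. -/
theorem monotoneOn_picone (h : IsAngularSolution μ w w₁) (hμ : 0 < μ) {a b ε : ℝ} (ha : 0 ≤ a)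
    (hb : b ≤ π) (hε : 0 < ε) (hab : μ * (b - a + ε) < π) :
    MonotoneOn (fun x => w x * w₁ x - μ * w x ^ 2 *
      (cos (μ * (x - (a - ε))) / sin (μ * (x - (a - ε))))) (Set.Icc a b) := by
  have hs : ∀ x ∈ Set.Icc a b, sin (μ * (x - (a - ε))) ≠ 0 := fun x hx => by
    refine (sin_pos_of_pos_of_lt_pi (mul_pos hμ (by linarith [hx.1])) (lt_of_le_of_lt ?_ hab)).ne'
    exact mul_le_mul_of_nonneg_left (by linarith [hx.2]) hμ.le
  have hd : ∀ x ∈ interior (Set.Icc a b), _ := fun x hx =>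
    h.hasDerivAt_picone (a - ε) (θ := x) (by
      rw [interior_Icc] at hx
      exact ⟨ha.trans_lt hx.1, hx.2.trans_le hb⟩) (hs x (interior_subset hx))
  refine monotoneOn_of_deriv_nonneg (convex_Icc a b) ?_
    (fun x hx => (hd x hx).differentiableAt.differentiableWithinAt) fun x hx => ?_
  · have h1 := h.continuous
    have h2 := h.continuous'
    refine ContinuousOn.sub (by fun_prop) (ContinuousOn.mul (by fun_prop)
      (ContinuousOn.div (by fun_prop) (by fun_prop) hs))
  · rw [(hd x hx).deriv]
    have hx' : x ∈ Set.Ioo 0 π := by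
      rw [interior_Icc] at hx
      exact ⟨ha.trans_lt hx.1, hx.2.trans_le hb⟩
    have := potential_lt μ hx'
    have : 0 ≤ (μ ^ 2 - potential μ x) * w x ^ 2 := mul_nonneg (by linarith) (sq_nonneg _)
    positivity

/-- Sturm comparison: zeros are separated by at least `π / μ`. -/
theorem pi_div_le_sub (h : IsAngularSolution μ w w₁) (hμ : 0 < μ) {a b : ℝ} (ha : 0 ≤ a)
    (hab : a < b) (hb : b ≤ π) (hwa : w a = 0) (hwb : w b = 0) : π / μ ≤ b - a := by
  by_contra! hlt
  set ε := (π / μ - (b - a)) / 2 with hε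
  have hε0 : 0 < ε := by linarith
  have hlt' : μ * (b - a + ε) < π := by
    have : b - a + ε < π / μ := by linarith
    calc μ * (b - a + ε) < μ * (π / μ) := mul_lt_mul_of_pos_left this hμ
      _ = π := by field_simp
  have hmono := h.monotoneOn_picone hμ ha hb hε0 hlt'
  obtain ⟨θ, hθ, hw⟩ := h.nontrivial a b ha hab hb
  have hθ' : θ ∈ Set.Ioo 0 π := ⟨ha.trans_lt hθ.1, hθ.2.trans_le hb⟩
  have hs : sin (μ * (θ - (a - ε))) ≠ 0 := by
    refine (sin_pos_of_pos_of_lt_pi (mul_pos hμ (by linarith [hθ.1])) (lt_trans ?_ hlt')).ne'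
    exact mul_lt_mul_of_pos_left (by linarith [hθ.2]) hμ
  have hd := h.hasDerivAt_picone (a - ε) hθ' hs
  -- The Picone function is monotone and vanishes at both ends, hence is zero in between, whereas
  -- its derivative is positive where `w θ ≠ 0`.
  have hconst : (fun x => w x * w₁ x - μ * w x ^ 2 *
      (cos (μ * (x - (a - ε))) / sin (μ * (x - (a - ε))))) =ᶠ[nhds θ] fun _ => 0 := by
    filter_upwards [Icc_mem_nhds hθ.1 hθ.2] with x hx
    have h1 := hmono (Set.left_mem_Icc.mpr hab.le) hx hx.1
    have h2 := hmono hx (Set.right_mem_Icc.mpr hab.le) hx.2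
    simp only [hwa, hwb] at h1 h2
    exact le_antisymm (by simpa using h2) (by simpa using h1)
  have h0 := hd.unique ((hasDerivAt_const θ (0 : ℝ)).congr_of_eventuallyEq hconst)
  have hpos : 0 < (μ ^ 2 - potential μ θ) * w θ ^ 2 :=
    mul_pos (by linarith [potential_lt μ hθ']) (by positivity)
  have hsq := sq_nonneg (w₁ θ - μ * w θ * (cos (μ * (θ - (a - ε))) / sin (μ * (θ - (a - ε)))))
  linarith

/-- With the comparison sine at phase `π / 2` at `θ`, the cotangent vanishes there, and monotonicity
of the Picone function from 0 to `θ` leaves `w w' ≥ 0`. -/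
theorem monotoneOn_sq (h : IsAngularSolution μ w w₁) (hμ : 1 ≤ μ) :
    MonotoneOn (fun θ => w θ ^ 2) (Set.Icc 0 (π / (2 * μ))) := by
  have hpi := pi_pos
  have hμ0 : 0 < μ := by linarith
  have hδ : π / (2 * μ) ≤ π / 2 := by gcongr; linarith
  refine monotoneOn_of_deriv_nonneg (convex_Icc _ _) (h.continuous.pow 2).continuousOn ?_ ?_
  all_goals
    rw [interior_Icc]
  · intro θ hθ
    exact ((h.hasDerivAt θ ⟨hθ.1, by linarith [hθ.2]⟩).pow
      2).differentiableAt.differentiableWithinAt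
  · intro θ hθ
    rw [((h.hasDerivAt θ ⟨hθ.1, by linarith [hθ.2]⟩).fun_pow 2).deriv]
    have harg : μ * (π / (2 * μ)) = π / 2 := by field_simp
    have hmono := h.monotoneOn_picone hμ0 le_rfl (b := θ) (by linarith [hθ.2])
      (ε := π / (2 * μ) - θ) (by linarith [hθ.2]) (by
        rw [show θ - 0 + (π / (2 * μ) - θ) = π / (2 * μ) by ring, harg]; linarith)
    have h1 := hmono (Set.left_mem_Icc.mpr hθ.1.le) (Set.right_mem_Icc.mpr hθ.1.le) hθ.1.le
    have h2 : θ - (0 - (π / (2 * μ) - θ)) = π / (2 * μ) := by ring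
    simp only [h.zero, h2, harg, cos_pi_div_two] at h1
    simp at h1
    norm_num
    linarith

/-- Sonin's monotone quantities. -/
theorem monotoneOn_potential_mul_sq_add (h : IsAngularSolution μ w w₁) {δ : ℝ} (hδ : 0 < δ) :
    MonotoneOn (fun θ => potential μ θ * w θ ^ 2 + w₁ θ ^ 2) (Set.Icc δ (π / 2)) := by
  have hmem : ∀ θ ∈ Set.Icc δ (π / 2), θ ∈ Set.Ioo 0 π := fun θ hθ =>
    ⟨hδ.trans_le hθ.1, by linarith [hθ.2, pi_pos]⟩
  have hd : ∀ θ ∈ Set.Icc δ (π / 2), HasDerivAt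
      (fun θ => potential μ θ * w θ ^ 2 + w₁ θ ^ 2) (3 / 2 * cos θ / sin θ ^ 3 * w θ ^ 2) θ := by
    intro θ hθ
    have := (((hasDerivAt_potential μ (hmem θ hθ)).fun_mul
      ((h.hasDerivAt θ (hmem θ hθ)).fun_pow 2)).fun_add
        ((h.hasDerivAt' θ (hmem θ hθ)).fun_pow 2))
    refine this.congr_deriv ?_
    norm_num
    ring
  refine monotoneOn_of_deriv_nonneg (convex_Icc _ _)
    (fun θ hθ => (hd θ hθ).continuousAt.continuousWithinAt)
    (fun θ hθ => (hd θ (interior_subset hθ)).differentiableAt.differentiableWithinAt)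
    fun θ hθ => ?_
  have hθ := interior_subset hθ
  rw [(hd θ hθ).deriv]
  have hs : 0 < sin θ := sin_pos_of_mem_Ioo (hmem θ hθ)
  have hc : 0 ≤ cos θ := cos_nonneg_of_mem_Icc ⟨by linarith [(hmem θ hθ).1, pi_pos], hθ.2⟩
  positivity

/-- The companion of the preceding quantity, divided by the increasing potential: the two opposite
monotonicities confine the amplitude of `w` from both sides. -/
theorem antitoneOn_sq_add_div (h : IsAngularSolution μ w w₁) {δ : ℝ} (hδ : 0 < δ)
    (hQ : 0 < potential μ δ) :
    AntitoneOn (fun θ => w θ ^ 2 + w₁ θ ^ 2 / potential μ θ) (Set.Icc δ (π / 2)) := by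
  have hmem : ∀ θ ∈ Set.Icc δ (π / 2), θ ∈ Set.Ioo 0 π := fun θ hθ =>
    ⟨hδ.trans_le hθ.1, by linarith [hθ.2, pi_pos]⟩
  have hQpos : ∀ θ ∈ Set.Icc δ (π / 2), 0 < potential μ θ := fun θ hθ =>
    hQ.trans_le (potential_mono μ hδ hθ.1 hθ.2)
  have hd : ∀ θ ∈ Set.Icc δ (π / 2), HasDerivAt
      (fun θ => w θ ^ 2 + w₁ θ ^ 2 / potential μ θ)
        (-(w₁ θ ^ 2 * (3 / 2 * cos θ / sin θ ^ 3) / potential μ θ ^ 2)) θ := by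
    intro θ hθ
    have hne := (hQpos θ hθ).ne'
    have := ((h.hasDerivAt θ (hmem θ hθ)).fun_pow 2).fun_add
      (((h.hasDerivAt' θ (hmem θ hθ)).fun_pow 2).fun_div
        (hasDerivAt_potential μ (hmem θ hθ)) hne)
    refine this.congr_deriv ?_
    generalize 3 / 2 * cos θ / sin θ ^ 3 = D
    field_simp
    norm_num
    ring
  refine antitoneOn_of_deriv_nonpos (convex_Icc _ _)
    (fun θ hθ => (hd θ hθ).continuousAt.continuousWithinAt)
    (fun θ hθ => (hd θ (interior_subset hθ)).differentiableAt.differentiableWithinAt)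
    fun θ hθ => ?_
  have hθ := interior_subset hθ
  rw [(hd θ hθ).deriv]
  have hs : 0 < sin θ := sin_pos_of_mem_Ioo (hmem θ hθ)
  have hc : 0 ≤ cos θ := cos_nonneg_of_mem_Icc ⟨by linarith [(hmem θ hθ).1, pi_pos], hθ.2⟩
  have := hQpos θ hθ
  rw [neg_nonpos]
  positivity

/-- The amplitude at `π / 2` serves as reference. The two Sonin quantities compare it with other
angles at the cost of a ratio of potentials, at most 4; below `π / (2 * μ)`, where the potential may
be negative, `monotoneOn_sq` takes over. -/
theorem energy_bounds (h : IsAngularSolution μ w w₁) (hμ : 1 ≤ μ) :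
    (∀ θ ∈ Set.Icc 0 (π / 2),
      w θ ^ 2 ≤ 4 * (w (π / 2) ^ 2 + w₁ (π / 2) ^ 2 / potential μ (π / 2))) ∧
    (∀ θ ∈ Set.Icc (π / (2 * μ)) (π / 2),
      w (π / 2) ^ 2 + w₁ (π / 2) ^ 2 / potential μ (π / 2)
        ≤ w θ ^ 2 + 4 * w₁ θ ^ 2 / μ ^ 2) := by
  have hpi := pi_pos
  have hμ0 : 0 < μ := by linarith
  set δ := π / (2 * μ) with hδ
  have hδ0 : 0 < δ := by positivity
  have hδ2 : δ ≤ π / 2 := by rw [hδ]; gcongr; linarith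
  have hQδ : μ ^ 2 / 4 ≤ potential μ δ := sq_div_four_le_potential hμ
  have hQ0 : 0 < potential μ δ := lt_of_lt_of_le (by positivity) hQδ
  have hQ1 : 0 < potential μ (π / 2) := hQ0.trans_le (potential_mono μ hδ0 hδ2 le_rfl)
  have hQle : potential μ (π / 2) ≤ μ ^ 2 := (potential_lt μ ⟨by positivity, by linarith⟩).le
  have hE := h.antitoneOn_sq_add_div hδ0 hQ0
  have hG := h.monotoneOn_potential_mul_sq_add hδ0
  set E := w (π / 2) ^ 2 + w₁ (π / 2) ^ 2 / potential μ (π / 2) with hEdef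
  have hE0 : 0 ≤ E := by positivity
  have hδE : w δ ^ 2 + w₁ δ ^ 2 / potential μ δ ≤ 4 * E := by
    have h1 := hG ⟨le_rfl, hδ2⟩ ⟨hδ2, le_rfl⟩ hδ2
    simp only at h1
    have h2 : potential μ δ * w δ ^ 2 + w₁ δ ^ 2
        = potential μ δ * (w δ ^ 2 + w₁ δ ^ 2 / potential μ δ) := by field_simp
    have h3 : potential μ (π / 2) * w (π / 2) ^ 2 + w₁ (π / 2) ^ 2
        = potential μ (π / 2) * E := by rw [hEdef]; field_simp
    rw [h2, h3] at h1
    have h4 : potential μ (π / 2) * E ≤ potential μ δ * (4 * E) := by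
      calc potential μ (π / 2) * E ≤ μ ^ 2 * E := by gcongr
        _ = μ ^ 2 / 4 * (4 * E) := by ring
        _ ≤ potential μ δ * (4 * E) := by gcongr
    exact le_of_mul_le_mul_left (h1.trans h4) hQ0
  have hpos : ∀ θ ∈ Set.Icc δ (π / 2), 0 < potential μ θ := fun θ hθ =>
    hQ0.trans_le (potential_mono μ hδ0 hθ.1 hθ.2)
  constructor
  · have hmid : ∀ θ ∈ Set.Icc δ (π / 2), w θ ^ 2 ≤ 4 * E := fun θ hθ => by
      have h1 := hE ⟨le_rfl, hδ2⟩ hθ hθ.1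
      simp only at h1
      have : 0 ≤ w₁ θ ^ 2 / potential μ θ := div_nonneg (sq_nonneg _) (hpos θ hθ).le
      linarith
    intro θ hθ
    rcases le_total θ δ with hle | hle
    · exact (h.monotoneOn_sq hμ ⟨hθ.1, hle⟩ ⟨hδ0.le, le_rfl⟩ hle).trans (hmid δ ⟨le_rfl, hδ2⟩)
    · exact hmid θ ⟨hle, hθ.2⟩
  · intro θ hθ
    have h1 := hE hθ ⟨hδ2, le_rfl⟩ hθ.2
    simp only at h1
    have h2 : w₁ θ ^ 2 / potential μ θ ≤ w₁ θ ^ 2 / (μ ^ 2 / 4) := by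
      gcongr
      exact hQδ.trans (potential_mono μ hδ0 hθ.1 hθ.2)
    have h3 : w₁ θ ^ 2 / (μ ^ 2 / 4) = 4 * w₁ θ ^ 2 / μ ^ 2 := by field_simp
    linarith

/-- The size of a solution is controlled by its derivative at any of its interior zeros. -/
theorem abs_le_of_zero (h : IsAngularSolution μ w w₁) (hμ : 1 ≤ μ) {θ φ : ℝ}
    (hθ : θ ∈ Set.Icc 0 π) (hφ : φ ∈ Set.Ioo 0 π) (hw : w φ = 0) :
    |w θ| ≤ 4 * |w₁ φ| / μ := by
  have hpi := pi_pos
  have hμ0 : 0 < μ := by linarith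
  have hle : π / (2 * μ) ≤ π / μ := by gcongr; linarith
  -- Sturm separation from the zeros at 0 and `π` puts `φ` in the range of the energy bounds; the
  -- reflected solution covers the right half.
  have hφ1 : π / (2 * μ) ≤ φ := by
    have := h.pi_div_le_sub hμ0 le_rfl hφ.1 hφ.2.le h.zero hw
    linarith
  have hφ2 : φ ≤ π - π / (2 * μ) := by
    have := h.pi_div_le_sub hμ0 hφ.1.le hφ.2 le_rfl hw h.pi
    linarith
  obtain ⟨a1, a2⟩ := h.energy_bounds hμ
  obtain ⟨b1, b2⟩ := h.reflect.energy_bounds hμ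
  simp only [neg_sq, sub_half] at b1 b2
  have hup : w θ ^ 2 ≤ 4 * (w (π / 2) ^ 2 + w₁ (π / 2) ^ 2 / potential μ (π / 2)) := by
    rcases le_total θ (π / 2) with hc | hc
    · exact a1 θ ⟨hθ.1, hc⟩
    · simpa using b1 (π - θ) ⟨by linarith [hθ.2], by linarith⟩
  have hlow : w (π / 2) ^ 2 + w₁ (π / 2) ^ 2 / potential μ (π / 2)
      ≤ w φ ^ 2 + 4 * w₁ φ ^ 2 / μ ^ 2 := by
    rcases le_total φ (π / 2) with hc | hc
    · exact a2 φ ⟨hφ1, hc⟩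
    · simpa using b2 (π - φ) ⟨by linarith, by linarith⟩
  rw [hw] at hlow
  refine abs_le_of_sq_le_sq' ?_ (by positivity) |> abs_le.mpr
  have : (4 * |w₁ φ| / μ) ^ 2 = 4 * (4 * w₁ φ ^ 2 / μ ^ 2) := by
    rw [div_pow, mul_pow, sq_abs]; ring
  rw [this]
  linarith

theorem deriv_ne_zero (h : IsAngularSolution μ w w₁) (hμ : 1 ≤ μ) {φ : ℝ} (hφ : φ ∈ Set.Ioo 0 π)
    (hw : w φ = 0) : w₁ φ ≠ 0 := by
  intro h0
  obtain ⟨θ, hθ, hne⟩ := h.nontrivial 0 π le_rfl pi_pos le_rfl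
  have := h.abs_le_of_zero hμ (Set.Ioo_subset_Icc_self hθ) hφ hw
  rw [h0] at this
  simp at this
  exact hne this

end IsAngularSolution

end HPInterp

/-! ### Angular form of the Lagrange functions and the Lebesgue constant -/

namespace HPInterp

open Real Polynomial

theorem eval_lobatto_cos (m : ℕ) (θ : ℝ) :
    (lobatto m).eval ((1 - cos θ) / 2)
      = -(sin θ ^ 2 / 4 * (derivative (legendre m)).eval ((1 - cos θ) / 2)) := by
  simp only [lobatto, eval_mul, eval_X, eval_sub, eval_one]
  rw [sin_sq]
  ring

theorem derivative_legendre_ode (m : ℕ) (θ : ℝ) :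
    sin θ ^ 2 / 4 * (derivative (derivative (derivative (legendre m)))).eval ((1 - cos θ) / 2)
      = -(2 * cos θ * (derivative (derivative (legendre m))).eval ((1 - cos θ) / 2))
        - ((m : ℝ) * (m + 1) - 2) * (derivative (legendre m)).eval ((1 - cos θ) / 2) := by
  have h := congrArg (fun p => (derivative p).eval ((1 - cos θ) / 2)) (legendre_ode m)
  simp only [derivative_add, derivative_mul, derivative_sub, derivative_X, derivative_one,
    derivative_C, derivative_ofNat, eval_add, eval_mul, eval_sub, eval_X, eval_one, eval_C,
    eval_ofNat, eval_zero, zero_mul, zero_add] at h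
  rw [sin_sq]
  linear_combination -h

/-- The Liouville transform of the derivative of the shifted Legendre polynomial. -/
noncomputable def angular (m : ℕ) (θ : ℝ) : ℝ :=
  sin θ * √(sin θ) * (derivative (legendre m)).eval ((1 - cos θ) / 2)

noncomputable def angularDeriv (m : ℕ) (θ : ℝ) : ℝ :=
  √(sin θ) * (3 / 2 * cos θ * (derivative (legendre m)).eval ((1 - cos θ) / 2)
    + sin θ ^ 2 / 2 * (derivative (derivative (legendre m))).eval ((1 - cos θ) / 2))

theorem hasDerivAt_eval_cos (p : ℝ[X]) (θ : ℝ) :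
    HasDerivAt (fun θ => p.eval ((1 - cos θ) / 2))
      ((derivative p).eval ((1 - cos θ) / 2) * (sin θ / 2)) θ := by
  have h : HasDerivAt (fun θ => (1 - cos θ) / 2) (sin θ / 2) θ := by
    simpa using ((hasDerivAt_cos θ).const_sub 1).div_const 2
  exact (p.hasDerivAt ((1 - cos θ) / 2)).comp θ h

/-- The factor `sin^{3/2}` removes the first-order term from the equation of the derivative of the
Legendre polynomial, and `(m + 1/2)² = m(m + 1) + 1/4`. -/
theorem isAngularSolution_angular {m : ℕ} (hm : 1 ≤ m) :
    IsAngularSolution (m + 1 / 2) (angular m) (angularDeriv m) where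
  continuous := by unfold angular; fun_prop
  continuous' := by unfold angularDeriv; fun_prop
  hasDerivAt θ hθ := by
    have hs : 0 < sin θ := sin_pos_of_mem_Ioo hθ
    have h := ((hasDerivAt_sin θ).fun_mul ((hasDerivAt_sin θ).sqrt hs.ne')).fun_mul
      (hasDerivAt_eval_cos (derivative (legendre m)) θ)
    refine h.congr_deriv ?_
    unfold angularDeriv
    have hr : √(sin θ) ≠ 0 := (sqrt_pos.mpr hs).ne'
    have h2 : sin θ * (cos θ / (2 * √(sin θ))) = √(sin θ) * cos θ / 2 := by
      field_simp
      rw [sq_sqrt hs.le]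
      ring
    rw [h2]
    ring
  hasDerivAt' θ hθ := by
    have hs : 0 < sin θ := sin_pos_of_mem_Ioo hθ
    have h := ((hasDerivAt_sin θ).sqrt hs.ne').fun_mul
      ((((hasDerivAt_cos θ).const_mul (3 / 2)).fun_mul
        (hasDerivAt_eval_cos (derivative (legendre m)) θ)).fun_add
        ((((hasDerivAt_sin θ).fun_pow 2).div_const 2).fun_mul
          (hasDerivAt_eval_cos (derivative (derivative (legendre m))) θ)))
    refine h.congr_deriv ?_
    have hode := derivative_legendre_ode m θ
    unfold angular potential
    have hr : √(sin θ) ≠ 0 := (sqrt_pos.mpr hs).ne'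
    have hcs := sin_sq_add_cos_sq θ
    have h2 : cos θ / (2 * √(sin θ)) = √(sin θ) * cos θ / (2 * sin θ) := by
      field_simp
      rw [sq_sqrt hs.le]
    rw [h2]
    generalize (derivative (derivative (derivative (legendre m)))).eval ((1 - cos θ) / 2) = q2 at *
    generalize (derivative (derivative (legendre m))).eval ((1 - cos θ) / 2) = q1 at *
    generalize (derivative (legendre m)).eval ((1 - cos θ) / 2) = q0 at *
    generalize √(sin θ) = r at *
    generalize sin θ = s at *
    generalize cos θ = c at *
    have hs' := hs.ne'
    field_simp
    push_cast
    linear_combination (16 * s ^ 2) * hode + 12 * q0 * hcs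
  zero := by simp [angular]
  pi := by simp [angular]
  nontrivial a b ha hab hb := by
    by_contra! hzero
    have hq : derivative (legendre m) ≠ 0 := fun h0 =>
      lobatto_ne_zero hm (by rw [lobatto, h0, mul_zero])
    have hinj : Set.InjOn (fun θ => (1 - cos θ) / 2) (Set.Ioo a b) := fun x hx y hy hxy => by
      refine injOn_cos ⟨ha.trans hx.1.le, hx.2.le.trans hb⟩
        ⟨ha.trans hy.1.le, hy.2.le.trans hb⟩ ?_
      simp only at hxy
      linarith
    have hinf := (Set.Ioo_infinite hab).image hinj
    refine hq (Polynomial.eq_zero_of_infinite_isRoot _ (hinf.mono ?_))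
    rintro _ ⟨θ, hθ, rfl⟩
    have hs : 0 < sin θ := sin_pos_of_mem_Ioo ⟨ha.trans_lt hθ.1, hθ.2.trans_le hb⟩
    have h := hzero θ hθ
    rw [angular, mul_eq_zero] at h
    exact h.resolve_left (mul_pos hs (sqrt_pos.mpr hs)).ne'

/-- The difference of cosines is `2 sin((θ+φ)/2) sin((θ-φ)/2)`. The first sine dominates the
arithmetic, hence geometric, mean of `sin θ` and `sin φ`; Jordan's inequality bounds the second. -/
theorem two_div_pi_mul_le_abs_cos_sub_cos {θ φ : ℝ} (hθ : θ ∈ Set.Icc 0 π)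
    (hφ : φ ∈ Set.Icc 0 π) :
    2 / π * (√(sin θ) * √(sin φ)) * |θ - φ| ≤ |cos φ - cos θ| := by
  have hsθ := sin_nonneg_of_mem_Icc hθ
  have hsφ := sin_nonneg_of_mem_Icc hφ
  have hcos : cos φ - cos θ = 2 * sin ((θ + φ) / 2) * sin ((θ - φ) / 2) := by
    rw [cos_sub_cos, add_comm φ θ, show (φ - θ) / 2 = -((θ - φ) / 2) by ring, sin_neg]
    ring
  have hmid : √(sin θ) * √(sin φ) ≤ sin ((θ + φ) / 2) := by
    have h1 : sin θ + sin φ = 2 * sin ((θ + φ) / 2) * cos ((θ - φ) / 2) := by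
      have e1 := sin_add ((θ + φ) / 2) ((θ - φ) / 2)
      have e2 := sin_sub ((θ + φ) / 2) ((θ - φ) / 2)
      rw [show (θ + φ) / 2 + (θ - φ) / 2 = θ by ring] at e1
      rw [show (θ + φ) / 2 - (θ - φ) / 2 = φ by ring] at e2
      rw [e1, e2]
      ring
    have h2 : 0 ≤ sin ((θ + φ) / 2) :=
      sin_nonneg_of_mem_Icc ⟨by linarith [hθ.1, hφ.1], by linarith [hθ.2, hφ.2]⟩
    have h3 := mul_le_mul_of_nonneg_left (cos_le_one ((θ - φ) / 2)) h2
    nlinarith [sq_nonneg (√(sin θ) - √(sin φ)), sq_sqrt hsθ, sq_sqrt hsφ]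
  have hdiff : 2 / π * (|θ - φ| / 2) ≤ |sin ((θ - φ) / 2)| := by
    have habs : |(θ - φ) / 2| = |θ - φ| / 2 := by rw [abs_div, abs_two]
    have h := mul_abs_le_abs_sin (x := (θ - φ) / 2) (by
      rw [habs]
      have : |θ - φ| ≤ π := abs_sub_le_iff.mpr ⟨by linarith [hθ.2, hφ.1], by linarith [hφ.2, hθ.1]⟩
      linarith)
    rwa [habs] at h
  have hnn : 0 ≤ √(sin θ) * √(sin φ) := by positivity
  have hmid0 := hnn.trans hmid
  rw [hcos, abs_mul, abs_mul, abs_two, abs_of_nonneg hmid0]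
  calc 2 / π * (√(sin θ) * √(sin φ)) * |θ - φ|
      = 2 * (√(sin θ) * √(sin φ)) * (2 / π * (|θ - φ| / 2)) := by ring
    _ ≤ 2 * sin ((θ + φ) / 2) * |sin ((θ - φ) / 2)| := by gcongr

theorem cos_arccos_one_sub {τ : ℝ} (hτ : τ ∈ Set.Icc (0 : ℝ) 1) :
    (1 - cos (arccos (1 - 2 * τ))) / 2 = τ := by
  rw [cos_arccos (by linarith [hτ.2]) (by linarith [hτ.1])]
  ring

theorem arccos_mem_Ioo {τ : ℝ} (hτ : τ ∈ Set.Ioo (0 : ℝ) 1) :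
    arccos (1 - 2 * τ) ∈ Set.Ioo 0 π :=
  ⟨arccos_pos.mpr (by linarith [hτ.1]), arccos_lt_pi.mpr (by linarith [hτ.2])⟩

section Lebesgue

variable {m : ℕ} {t : Fin (m + 1) → ℝ}

theorem angular_arccos_eq_zero {τ : ℝ} (hτ : τ ∈ Set.Icc (0 : ℝ) 1)
    (h : (lobatto m).eval τ = 0) : angular m (arccos (1 - 2 * τ)) = 0 := by
  rw [← cos_arccos_one_sub hτ, eval_lobatto_cos] at h
  rw [angular]
  rcases mul_eq_zero.mp (neg_eq_zero.mp h) with h | h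
  · have : sin (arccos (1 - 2 * τ)) = 0 := by
      have h2 : sin (arccos (1 - 2 * τ)) ^ 2 = 0 := by linarith
      exact pow_eq_zero_iff two_ne_zero |>.mp h2
    simp [this]
  · rw [h, mul_zero]

/-- The angles of the Gauss–Lobatto points are separated. -/
theorem IsVandermondeFekete.angle_separated (hm : 1 ≤ m) (h : IsVandermondeFekete t)
    {j k : Fin (m + 1)} (hjk : j ≠ k) :
    π / (m + 1 / 2) ≤ |arccos (1 - 2 * t j) - arccos (1 - 2 * t k)| := by
  have hsol := isAngularSolution_angular hm
  have hzero : ∀ j, angular m (arccos (1 - 2 * t j)) = 0 := fun j =>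
    angular_arccos_eq_zero (h.mem j) (by
      have : t j ∈ {τ | (lobatto m).eval τ = 0} := h.range_eq hm ▸ Set.mem_range_self j
      exact this)
  have hne : arccos (1 - 2 * t j) ≠ arccos (1 - 2 * t k) := fun heq => hjk <| h.injective <| by
    rw [← cos_arccos_one_sub (h.mem j), ← cos_arccos_one_sub (h.mem k), heq]
  have hμ : (0 : ℝ) < m + 1 / 2 := by positivity
  rcases lt_or_gt_of_ne hne with hlt | hlt
  · rw [abs_sub_comm]
    exact (hsol.pi_div_le_sub hμ (arccos_nonneg _) hlt (arccos_le_pi _) (hzero j)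
      (hzero k)).trans (le_abs_self _)
  · exact (hsol.pi_div_le_sub hμ (arccos_nonneg _) hlt (arccos_le_pi _) (hzero k)
      (hzero j)).trans (le_abs_self _)

/-- The classical formula `ω(τ) / ((τ - t j) ω'(t j))` for a Lagrange polynomial does not change
when `ω` is rescaled to `lobatto m`. -/
theorem IsVandermondeFekete.eval_basis_mul (hm : 1 ≤ m) (h : IsVandermondeFekete t)
    (j : Fin (m + 1)) (τ : ℝ) :
    (Lagrange.basis Finset.univ t j).eval τ * ((τ - t j) * (derivative (lobatto m)).eval (t j))
      = (lobatto m).eval τ := by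
  obtain ⟨κ, hκ, heq⟩ := h.exists_nodal_eq hm
  have hj := Finset.mem_univ j
  have hbasis : Lagrange.basis Finset.univ t j
      = C (Lagrange.nodalWeight Finset.univ t j) *
        Lagrange.nodal (Finset.univ.erase j) t := by
    rw [Lagrange.basis_eq_prod_sub_inv_mul_nodal_div hj, Lagrange.nodal_erase_eq_nodal_div hj]
  have hw := Lagrange.nodalWeight_ne_zero h.injective.injOn hj
  have hw' := Lagrange.nodalWeight_eq_eval_derivative_nodal (v := t) hj
  have hd : (derivative (Lagrange.nodal Finset.univ t)).eval (t j)
      = (Lagrange.nodalWeight Finset.univ t j)⁻¹ := by rw [hw', inv_inv]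
  have hτ : (Lagrange.nodal Finset.univ t).eval τ
      = (τ - t j) * (Lagrange.nodal (Finset.univ.erase j) t).eval τ := by
    rw [Lagrange.nodal_eq_mul_nodal_erase hj]; simp
  rw [heq, hbasis, derivative_C_mul]
  simp only [eval_mul, eval_C, hd, hτ]
  field_simp

/-- In the angular variable the Lagrange polynomial is `√(sin θ sin φ) w(θ) / ((cos φ - cos θ)
w'(φ))`. The root cancels against the lower bound for the cosine difference, and `4 / μ` over `2 /
π` gives the constant. -/
theorem IsVandermondeFekete.abs_eval_basis_mul_le (hm : 1 ≤ m) (h : IsVandermondeFekete t)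
    {j : Fin (m + 1)} (hj : t j ∈ Set.Ioo (0 : ℝ) 1) {τ : ℝ} (hτ : τ ∈ Set.Icc (0 : ℝ) 1) :
    |(Lagrange.basis Finset.univ t j).eval τ| * |arccos (1 - 2 * τ) - arccos (1 - 2 * t j)|
      ≤ 2 * (π / (m + 1 / 2)) := by
  have hsol := isAngularSolution_angular hm
  have hμ : (1 : ℝ) ≤ m + 1 / 2 := by
    have : (1 : ℝ) ≤ m := by exact_mod_cast hm
    linarith
  have hroot : (lobatto m).eval (t j) = 0 := by
    have : t j ∈ {τ | (lobatto m).eval τ = 0} := h.range_eq hm ▸ Set.mem_range_self j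
    exact this
  have hid := h.eval_basis_mul hm j τ
  have hφ := arccos_mem_Ioo hj
  have hφt := cos_arccos_one_sub (h.mem j)
  have hθt := cos_arccos_one_sub hτ
  have hθ : arccos (1 - 2 * τ) ∈ Set.Icc 0 π := ⟨arccos_nonneg _, arccos_le_pi _⟩
  have hwφ := angular_arccos_eq_zero (h.mem j) hroot
  set φ := arccos (1 - 2 * t j)
  set θ := arccos (1 - 2 * τ)
  set ℓ := (Lagrange.basis Finset.univ t j).eval τ
  have hsφ : 0 < sin φ := sin_pos_of_mem_Ioo hφ
  have hsθ : 0 ≤ sin θ := sin_nonneg_of_mem_Icc hθ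
  have hq : (derivative (legendre m)).eval (t j) = 0 := by
    rw [← hφt, eval_lobatto_cos, neg_eq_zero, mul_eq_zero] at hroot
    rw [← hφt]
    exact hroot.resolve_left (by positivity)
  have hd : √(sin φ) * (derivative (lobatto m)).eval (t j) = -(angularDeriv m φ / 2) := by
    rw [angularDeriv, lobatto, hφt, hq]
    simp only [derivative_mul, eval_add, eval_mul, hq, eval_X, eval_sub, eval_one]
    rw [sin_sq, ← hφt]
    ring
  have hτw : (lobatto m).eval τ = -(√(sin θ) * angular m θ / 4) := by
    rw [angular, ← hθt, eval_lobatto_cos, hθt]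
    have := mul_self_sqrt hsθ
    linear_combination (sin θ * (derivative (legendre m)).eval τ / 4) * this
  have hkey : ℓ * (cos φ - cos θ) * angularDeriv m φ = √(sin θ) * √(sin φ) * angular m θ := by
    have h1 : τ - t j = (cos φ - cos θ) / 2 := by rw [← hφt, ← hθt]; ring
    rw [h1, hτw] at hid
    linear_combination 2 * ℓ * (cos φ - cos θ) * hd - (4 * √(sin φ)) * hid
  have hw1 : 0 < |angularDeriv m φ| := abs_pos.mpr (hsol.deriv_ne_zero hμ hφ hwφ)
  have hup := hsol.abs_le_of_zero hμ hθ hφ hwφ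
  have hcos := two_div_pi_mul_le_abs_cos_sub_cos hθ (Set.Ioo_subset_Icc_self hφ)
  have hkey' := congrArg abs hkey
  rw [abs_mul, abs_mul, abs_mul, abs_of_nonneg (by positivity : 0 ≤ √(sin θ) * √(sin φ))] at hkey'
  have hpi := pi_pos
  -- When `sin θ = 0` the root cannot be cancelled, but then `τ` is an end point and the Lagrange
  -- polynomial vanishes there.
  rcases hsθ.eq_or_lt with h0 | hpos
  · have hne : τ ≠ t j := fun heq => by
      have : θ = φ := by simp only [θ, φ, heq]
      rw [this] at h0
      exact hsφ.ne h0
    have hℓ : ℓ = 0 := by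
      have hcne : cos φ - cos θ ≠ 0 := fun hc => hne (by rw [← hφt, ← hθt]; linarith)
      rw [← h0] at hkey
      simp only [sqrt_zero, zero_mul, mul_eq_zero, hcne, abs_pos.mp hw1, or_false] at hkey
      exact hkey
    rw [hℓ, abs_zero, zero_mul]
    positivity
  · set S := √(sin θ) * √(sin φ)
    have hS : 0 < S := mul_pos (sqrt_pos.mpr hpos) (sqrt_pos.mpr hsφ)
    have hchain : (2 / π * S * |angularDeriv m φ|) * (|ℓ| * |θ - φ|)
        ≤ (2 / π * S * |angularDeriv m φ|) * (2 * (π / (m + 1 / 2))) := by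
      calc (2 / π * S * |angularDeriv m φ|) * (|ℓ| * |θ - φ|)
          = |ℓ| * (2 / π * S * |θ - φ|) * |angularDeriv m φ| := by ring
        _ ≤ |ℓ| * |cos φ - cos θ| * |angularDeriv m φ| := by gcongr
        _ = S * |angular m θ| := hkey'
        _ ≤ S * (4 * |angularDeriv m φ| / (m + 1 / 2)) := by gcongr
        _ = _ := by field_simp; norm_num
    exact le_of_mul_le_mul_left hchain (by positivity)

end Lebesgue

/-- A sum over separated points to the right of `x` of terms decaying like the inverse
distance. -/
theorem sum_le_of_separated {ι : Type*} {s : Finset ι} {θ L : ι → ℝ} {x h c : ℝ} (hh : 0 < h)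
    (hc : 0 ≤ c) (M : ℕ) (hx : ∀ j ∈ s, x ≤ θ j) (hM : ∀ j ∈ s, θ j < x + (M + 1) * h)
    (hsep : ∀ j ∈ s, ∀ k ∈ s, j ≠ k → h ≤ |θ j - θ k|) (h1 : ∀ j ∈ s, L j ≤ 1)
    (hL : ∀ j ∈ s, L j * |x - θ j| ≤ c * h) :
    ∑ j ∈ s, L j ≤ 1 + c * (1 + Real.log M) := by
  -- Half-open bins of width `h` counted from `x`: separation allows one point per bin. Bin 0 is
  -- bounded by 1, bin `k` by `c / k`.
  set κ : ι → ℕ := fun j => ⌊(θ j - x) / h⌋₊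
  have hnn : ∀ j ∈ s, 0 ≤ (θ j - x) / h := fun j hj => div_nonneg (by linarith [hx j hj]) hh.le
  have hκ1 : ∀ j ∈ s, κ j * h ≤ θ j - x := fun j hj =>
    (le_div_iff₀ hh).mp (Nat.floor_le (hnn j hj))
  have hκ2 : ∀ j ∈ s, θ j - x < (κ j + 1) * h := fun j _ =>
    (div_lt_iff₀ hh).mp (Nat.lt_floor_add_one _)
  set g : ℕ → ℝ := fun k => if k = 0 then 1 else c * (k : ℝ)⁻¹
  have hterm : ∀ j ∈ s, L j ≤ g (κ j) := fun j hj => by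
    by_cases h0 : κ j = 0
    · simp only [g, h0, if_true]; exact h1 j hj
    · simp only [g, h0, if_false]
      have hk : (0 : ℝ) < κ j := by exact_mod_cast Nat.pos_of_ne_zero h0
      rw [← div_eq_mul_inv, le_div_iff₀ hk]
      rcases le_or_gt (L j) 0 with hneg | hpos
      · exact (mul_nonpos_of_nonpos_of_nonneg hneg hk.le).trans hc
      · have h2 := hL j hj
        rw [abs_sub_comm, abs_of_nonneg (by linarith [hx j hj])] at h2
        have h3 : L j * (κ j * h) ≤ L j * (θ j - x) :=
          mul_le_mul_of_nonneg_left (hκ1 j hj) hpos.le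
        exact le_of_mul_le_mul_right (by linarith) hh
  have hinj : Set.InjOn κ s := fun j hj k hk hjk => by
    by_contra hne
    have h2 := hsep j hj k hk hne
    have a1 := hκ1 j hj
    have a2 := hκ2 j hj
    have b1 := hκ1 k hk
    have b2 := hκ2 k hk
    rw [hjk] at a1 a2
    have : |θ j - θ k| < h := abs_sub_lt_iff.mpr ⟨by linarith, by linarith⟩
    linarith
  have hrange : s.image κ ⊆ Finset.range (M + 1) := fun k hk => by
    obtain ⟨j, hj, rfl⟩ := Finset.mem_image.mp hk
    rw [Finset.mem_range, Nat.floor_lt (hnn j hj), div_lt_iff₀ hh]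
    push_cast
    linarith [hM j hj]
  have hg : ∀ k, 0 ≤ g k := fun k => by
    simp only [g]; split_ifs <;> positivity
  calc ∑ j ∈ s, L j ≤ ∑ j ∈ s, g (κ j) := Finset.sum_le_sum hterm
    _ = ∑ k ∈ s.image κ, g k := (Finset.sum_image hinj).symm
    _ ≤ ∑ k ∈ Finset.range (M + 1), g k :=
        Finset.sum_le_sum_of_subset_of_nonneg hrange fun k _ _ => hg k
    _ = 1 + c * (harmonic M : ℝ) := by
        rw [Finset.sum_range_succ', add_comm, harmonic]
        simp [g, Finset.mul_sum]
    _ ≤ 1 + c * (1 + Real.log M) := by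
        gcongr
        exact harmonic_le_one_add_log M

/-- The Lebesgue constant of the Gauss–Lobatto points grows at most logarithmically. -/
theorem IsVandermondeFekete.sum_abs_eval_basis_le {m : ℕ} (hm : 2 ≤ m) {t : Fin (m + 1) → ℝ}
    (h : IsVandermondeFekete t) {τ : ℝ} (hτ : τ ∈ Set.Icc (0 : ℝ) 1) :
    ∑ j, |(Lagrange.basis Finset.univ t j).eval τ| ≤ 16 * Real.log m := by
  have hm1 : 1 ≤ m := by omega
  have hpi := pi_pos
  set L : Fin (m + 1) → ℝ := fun j => |(Lagrange.basis Finset.univ t j).eval τ|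
  set θ : Fin (m + 1) → ℝ := fun j => arccos (1 - 2 * t j)
  set x := arccos (1 - 2 * τ)
  set η := π / (m + 1 / 2 : ℝ)
  have hη : 0 < η := by positivity
  have hηpi : π < (m + 1) * η := by
    have : π = (m + 1 / 2) * η := by simp only [η]; field_simp
    nlinarith
  have hL1 : ∀ j, L j ≤ 1 := fun j => h.abs_eval_basis_le j hτ
  have hθ : ∀ j, 0 ≤ θ j ∧ θ j ≤ π := fun j => ⟨arccos_nonneg _, arccos_le_pi _⟩
  have hx : 0 ≤ x ∧ x ≤ π := ⟨arccos_nonneg _, arccos_le_pi _⟩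
  have hsep : ∀ j k, j ≠ k → η ≤ |θ j - θ k| := fun j k hjk => h.angle_separated hm1 hjk
  classical
  let I : Finset (Fin (m + 1)) := Finset.univ.filter fun j => t j ∈ Set.Ioo (0 : ℝ) 1
  have hI : ∀ j ∈ I, L j * |x - θ j| ≤ 2 * η := fun j hj =>
    h.abs_eval_basis_mul_le hm1 (Finset.mem_filter.mp hj).2 hτ
  have hright : ∑ j ∈ I with x ≤ θ j, L j ≤ 1 + 2 * (1 + Real.log m) :=
    sum_le_of_separated hη zero_le_two m (fun j hj => (Finset.mem_filter.mp hj).2)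
      (fun j _ => by linarith [(hθ j).2]) (fun j _ k _ => hsep j k) (fun j _ => hL1 j)
      fun j hj => hI j (Finset.mem_filter.mp hj).1
  have hleft : ∑ j ∈ I with ¬ x ≤ θ j, L j ≤ 1 + 2 * (1 + Real.log m) :=
    sum_le_of_separated (θ := fun j => -θ j) (x := -x) hη zero_le_two m
      (fun j hj => by linarith [not_le.mp (Finset.mem_filter.mp hj).2])
      (fun j _ => by linarith [(hθ j).1])
      (fun j _ k _ hjk => by
        rw [neg_sub_neg, abs_sub_comm]; exact hsep j k hjk) (fun j _ => hL1 j)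
      fun j hj => by
        rw [neg_sub_neg, abs_sub_comm]; exact hI j (Finset.mem_filter.mp hj).1
  -- The decay estimate needs an interior zero of `w`, so the at most two end nodes are bounded by 1
  -- each.
  have hends : ∑ j with ¬ t j ∈ Set.Ioo (0 : ℝ) 1, L j ≤ 2 := by
    have hcard : (Finset.univ.filter fun j => ¬ t j ∈ Set.Ioo (0 : ℝ) 1).card ≤ 2 := by
      rw [← Finset.card_image_of_injective _ h.injective]
      refine (Finset.card_le_card (t := {0, 1}) fun y hy => ?_).trans Finset.card_le_two
      obtain ⟨j, hj, rfl⟩ := Finset.mem_image.mp hy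
      have hj := (Finset.mem_filter.mp hj).2
      have hmem := h.mem j
      rw [Finset.mem_insert, Finset.mem_singleton]
      by_contra! hne
      exact hj ⟨lt_of_le_of_ne hmem.1 hne.1.symm, lt_of_le_of_ne hmem.2 hne.2⟩
    calc _ ≤ ∑ j with ¬ t j ∈ Set.Ioo (0 : ℝ) 1, (1 : ℝ) := Finset.sum_le_sum fun j _ => hL1 j
      _ ≤ 2 := by
        rw [Finset.sum_const, nsmul_eq_mul, mul_one]
        exact_mod_cast hcard
  have hsplit1 := Finset.sum_filter_add_sum_filter_not Finset.univ
    (fun j => t j ∈ Set.Ioo (0 : ℝ) 1) L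
  have hsplit2 := Finset.sum_filter_add_sum_filter_not I (fun j => x ≤ θ j) L
  have hlog : 0.69 ≤ Real.log m :=
    (by linarith [Real.log_two_gt_d9] : 0.69 ≤ Real.log 2).trans
      (Real.log_le_log two_pos (by exact_mod_cast hm))
  -- The total is at most `8 + 4 log m`, and `8 ≤ 12 * 0.69 ≤ 12 log m`.
  calc ∑ j, L j = ∑ j ∈ I, L j + ∑ j with ¬ t j ∈ Set.Ioo (0 : ℝ) 1, L j := hsplit1.symm
    _ ≤ 16 * Real.log m := by linarith

end HPInterp

/-! ### Transfer to the faces of the triangle and conclusion -/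

namespace HPInterp

open Polynomial Matrix

section Face

variable {i : Fin 3}

/-- The affine coordinate on the face `i` which is `0` and `1` at its two end points. -/
noncomputable def faceCoord (p : face i) : ℝ := nodal (i + 2) p

theorem nodal_right_lineMap (i : Fin 3) (τ : ℝ) :
    nodal (i + 2) (AffineMap.lineMap (vertex (i + 1)) (vertex (i + 2)) τ) = τ := by
  have h3 : √3 ≠ 0 := by positivity
  fin_cases i <;> simp [nodal, vertex, AffineMap.lineMap_apply, h3] <;> (try field_simp) <;> (try ring)

theorem nodal_left_lineMap (i : Fin 3) (τ : ℝ) :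
    nodal (i + 1) (AffineMap.lineMap (vertex (i + 1)) (vertex (i + 2)) τ) = 1 - τ := by
  have h3 : √3 ≠ 0 := by positivity
  fin_cases i <;> simp [nodal, vertex, AffineMap.lineMap_apply, h3] <;> (try field_simp) <;> (try ring)

theorem exists_lineMap_eq (p : face i) : ∃ τ ∈ Set.Icc (0 : ℝ) 1,
    AffineMap.lineMap (vertex (i + 1)) (vertex (i + 2)) τ = (p : ℝ × ℝ) := by
  have h : (p : ℝ × ℝ) ∈ segment ℝ (vertex (i + 1)) (vertex (i + 2)) := p.2
  rw [segment_eq_image_lineMap] at h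
  exact h

theorem lineMap_faceCoord (p : face i) :
    AffineMap.lineMap (vertex (i + 1)) (vertex (i + 2)) (faceCoord p) = (p : ℝ × ℝ) := by
  obtain ⟨τ, -, h⟩ := exists_lineMap_eq p
  rw [faceCoord, ← h, nodal_right_lineMap]

theorem faceCoord_mem (p : face i) : faceCoord p ∈ Set.Icc (0 : ℝ) 1 := by
  obtain ⟨τ, hτ, h⟩ := exists_lineMap_eq p
  rwa [faceCoord, ← h, nodal_right_lineMap]

theorem exists_faceCoord_eq (i : Fin 3) {τ : ℝ} (hτ : τ ∈ Set.Icc (0 : ℝ) 1) :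
    ∃ p : face i, faceCoord p = τ := by
  refine ⟨⟨AffineMap.lineMap (vertex (i + 1)) (vertex (i + 2)) τ, ?_⟩, nodal_right_lineMap i τ⟩
  rw [face, segment_eq_image_lineMap]
  exact ⟨τ, hτ, rfl⟩

theorem faceCoord_injective : Function.Injective (faceCoord (i := i)) := fun p q h =>
  Subtype.ext (by rw [← lineMap_faceCoord p, ← lineMap_faceCoord q, h])

theorem faceCoord_faceLeft : faceCoord (faceLeft i) = 0 := by
  have h := nodal_right_lineMap i 0
  rwa [AffineMap.lineMap_apply_zero] at h

theorem faceCoord_faceRight : faceCoord (faceRight i) = 1 := by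
  have h := nodal_right_lineMap i 1
  rwa [AffineMap.lineMap_apply_one] at h

theorem nodal_left_eq (p : face i) : nodal (i + 1) p = 1 - faceCoord p := by
  rw [← nodal_left_lineMap i, lineMap_faceCoord]

/-- Polynomials of degree `m` on a face are polynomials of degree `m` in the face coordinate. -/
theorem exists_polynomial_of_mem_polySpace {m : ℕ} {u : C(face i, ℝ)}
    (hu : u ∈ polySpace (face i) m) :
    ∃ G : ℝ[X], G.natDegree ≤ m ∧ ∀ p, u p = G.eval (faceCoord p) := by
  obtain ⟨F, hF, rfl⟩ := hu
  set a := vertex (i + 1)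
  set b := vertex (i + 2)
  let lin : Fin 2 → ℝ[X] := ![C (b.1 - a.1) * X + C a.1, C (b.2 - a.2) * X + C a.2]
  refine ⟨MvPolynomial.aeval lin F, ?_, fun p => ?_⟩
  · have h := MvPolynomial.aeval_natDegree_le F
      ((MvPolynomial.mem_restrictTotalDegree _ _ _).mp hF) lin (n := 1) fun k => by
        fin_cases k <;> exact natDegree_linear_le
    simpa using h
  · have hhom : (ContinuousMap.evalAlgHom ℝ ℝ p).comp (polyRestrict (face i))
        = (Polynomial.aeval (faceCoord p)).comp (MvPolynomial.aeval lin) := by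
      refine MvPolynomial.algHom_ext fun k => ?_
      have hp := lineMap_faceCoord p
      have h1 := congrArg Prod.fst hp
      have h2 := congrArg Prod.snd hp
      fin_cases k <;>
      simp [polyRestrict, lin, ← h1, ← h2, AffineMap.lineMap_apply, a, b, mul_comm]
    exact DFunLike.congr_fun hhom F

/-- Every collocation determinant is the Vandermonde determinant of the face coordinates times one
coefficient determinant, nonzero because the maximal determinant is. -/
theorem IsFaceFekete.isVandermondeFekete {m : ℕ} {x : Fin (m + 1) → face i}
    (h : IsFaceFekete x) : IsVandermondeFekete fun j => faceCoord (x j) := by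
  obtain ⟨g, hg⟩ := h
  have hli : LinearIndependent ℝ fun j => (g j : C(face i, ℝ)) :=
    g.linearIndependent.map' (Submodule.subtype _) (Submodule.ker_subtype _)
  choose G hdeg hG using fun j => exists_polynomial_of_mem_polySpace (g j).2
  have hdet : ∀ y : Fin (m + 1) → face i,
      (Matrix.of fun a j => (g j : C(face i, ℝ)) (y a)).det
        = (vandermonde fun a => faceCoord (y a)).det
          * (Matrix.of fun k j : Fin (m + 1) => (G j).coeff k).det := by
    intro y
    rw [← Matrix.det_mul]
    congr 1
    ext a j
    rw [Matrix.of_apply, hG, eval_eq_sum_range' (Nat.lt_succ_of_le (hdeg j)), Matrix.mul_apply,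
      ← Fin.sum_univ_eq_sum_range fun k => (G j).coeff k * faceCoord (y a) ^ k]
    exact Finset.sum_congr rfl fun k _ => by simp [vandermonde_apply, mul_comm]
  have hne := hg.det_ne_zero hli
  rw [hdet] at hne
  refine ⟨fun j => faceCoord_mem _, fun y hy => ?_⟩
  choose p hp using fun j => exists_faceCoord_eq i (hy j)
  have h1 := hg p
  rw [hdet, hdet, abs_mul, abs_mul] at h1
  simp only [hp] at h1
  exact le_of_mul_le_mul_right h1 (abs_pos.mpr (right_ne_zero_of_mul hne))

theorem IsFaceGaussLobatto.isVandermondeFekete {m : ℕ} (hm : 1 ≤ m) {x : Fin (m + 1) → face i}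
    (h : IsFaceGaussLobatto x) : IsVandermondeFekete fun j => faceCoord (x j) := by
  obtain ⟨hinj, hr⟩ := h
  refine isVandermondeFekete_of_range_eq hm (faceCoord_injective.comp hinj) ?_
  have h1 : Set.range (fun j => faceCoord (x j))
      = nodal (i + 2) '' Set.range fun j => (x j : ℝ × ℝ) := by
    rw [← Set.range_comp]; rfl
  rw [h1, hr, Set.image_image]
  simp only [nodal_right_lineMap, Set.image_id']
  ext τ
  simp [lobatto, legendre, sub_eq_zero, or_assoc, derivative_map, aeval_def, eval_map]

/-- The polynomial in the face coordinate that represents a combination of side shape functions and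
of the two nodal functions. -/
noncomputable def sidePoly (Φ : ℕ → ℝ[X]) (n : ℕ) : ((Fin n → ℝ) × ℝ × ℝ) →ₗ[ℝ] ℝ[X] where
  toFun c := X * (1 - X) * (∑ k, C (c.1 k) * Φ k).comp (2 * X - 1)
    + C c.2.1 * (1 - X) + C c.2.2 * X
  map_add' c d := by
    simp only [Prod.fst_add, Prod.snd_add, Pi.add_apply, C_add, add_mul, Finset.sum_add_distrib,
      add_comp]
    ring
  map_smul' r c := by
    simp only [Prod.smul_fst, Prod.smul_snd, Pi.smul_apply, smul_eq_mul, C_mul, mul_assoc,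
      ← Finset.mul_sum, mul_comp, C_comp, RingHom.id_apply, smul_eq_C_mul]
    ring

theorem externalComb_apply (Φ : ℕ → ℝ[X]) {m : ℕ} (f : C(face i, ℝ)) (c : Fin (m - 1) → ℝ)
    (p : face i) :
    externalComb Φ f c p
      = (sidePoly Φ (m - 1) (c, f (faceLeft i), f (faceRight i))).eval (faceCoord p) := by
  have hr : nodal (i + 2) (p : ℝ × ℝ) = faceCoord p := rfl
  have harg : faceCoord p - (1 - faceCoord p) = 2 * faceCoord p - 1 := by ring
  simp only [externalComb, sidePoly, sideShape, ContinuousMap.restrict_apply,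
    ContinuousMap.add_apply, ContinuousMap.sum_apply, ContinuousMap.smul_apply,
    ContinuousMap.mul_apply, ContinuousMap.coe_mk, nodal_left_eq, hr, harg, LinearMap.coe_mk,
    AddHom.coe_mk, eval_add, eval_mul, eval_sub, eval_X, eval_one, eval_C, eval_comp,
    eval_finsetSum, eval_ofNat, smul_eq_mul, Finset.mul_sum]
  congr 2
  exact Finset.sum_congr rfl fun k _ => by ring

theorem natDegree_sidePoly_le {Φ : ℕ → ℝ[X]} (hΦ : ∀ k, (Φ k).degree = (k : WithBot ℕ)) (n : ℕ)
    (c : (Fin n → ℝ) × ℝ × ℝ) : (sidePoly Φ n c).natDegree ≤ n + 1 := by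
  -- For `n = 0` the bubble part is absent; otherwise its degree is at most `2 + (n - 1)`.
  rcases n with _ | n
  · have : sidePoly Φ 0 c = C c.2.1 * (1 - X) + C c.2.2 * X := by simp [sidePoly]
    rw [this]
    compute_degree
  · have hsum : (∑ k : Fin (n + 1), C (c.1 k) * Φ k).natDegree ≤ n :=
      natDegree_sum_le_of_forall_le _ _ fun k _ => (natDegree_C_mul_le _ _).trans
        ((natDegree_eq_of_degree_eq_some (hΦ k)).trans_le (Nat.lt_succ_iff.mp k.isLt))
    have hlin : (2 * X - 1 : ℝ[X]).natDegree ≤ 1 := by compute_degree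
    have hcomp : ((∑ k : Fin (n + 1), C (c.1 k) * Φ k).comp (2 * X - 1)).natDegree ≤ n :=
      natDegree_comp_le.trans (by nlinarith)
    have hX : (X * (1 - X) : ℝ[X]).natDegree ≤ 2 := by compute_degree
    have hend : (C c.2.1 * (1 - X) + C c.2.2 * X).natDegree ≤ 1 := by compute_degree
    have heq : sidePoly Φ (n + 1) c
        = X * (1 - X) * (∑ k : Fin (n + 1), C (c.1 k) * Φ k).comp (2 * X - 1)
          + (C c.2.1 * (1 - X) + C c.2.2 * X) := by
      simp only [sidePoly, LinearMap.coe_mk, AddHom.coe_mk, add_assoc]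
    rw [heq]
    refine natDegree_add_le_of_degree_le ?_ (hend.trans (by omega))
    exact natDegree_mul_le.trans (by omega)

/-- Evaluation at 0 and 1 isolates the two end values. Dividing by `X * (1 - X)` leaves the `Φ k`,
independent because their degrees are distinct. -/
theorem sidePoly_injective {Φ : ℕ → ℝ[X]} (hΦ : ∀ k, (Φ k).degree = (k : WithBot ℕ)) (n : ℕ) :
    Function.Injective (sidePoly Φ n) := by
  rw [injective_iff_map_eq_zero]
  intro c hc
  have hc' : X * (1 - X) * (∑ k, C (c.1 k) * Φ k).comp (2 * X - 1)
      + C c.2.1 * (1 - X) + C c.2.2 * X = 0 := hc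
  have hα : c.2.1 = 0 := by simpa using congrArg (eval 0) hc'
  have hβ : c.2.2 = 0 := by simpa using congrArg (eval 1) hc'
  rw [hα, hβ, C_0, zero_mul, zero_mul, add_zero, add_zero] at hc'
  have hX : (X * (1 - X) : ℝ[X]) ≠ 0 := by
    refine mul_ne_zero X_ne_zero fun h => ?_
    simpa using congrArg (eval 0) h
  have hsum : ∑ k : Fin n, C (c.1 k) * Φ k = 0 := by
    have h := (mul_eq_zero.mp hc').resolve_left hX
    rcases comp_eq_zero_iff.mp h with h | ⟨-, h⟩
    · exact h
    · have := congrArg (fun r => r.coeff 1) h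
      simp [coeff_one, ← map_ofNat (C : ℝ →+* ℝ[X]) 2] at this
  have hli := (Polynomial.Sequence.linearIndependent (⟨Φ, hΦ⟩ : Polynomial.Sequence ℝ)).comp
    (Fin.val : Fin n → ℕ) Fin.val_injective
  have hz := Fintype.linearIndependent_iff.mp hli c.1 (by
    rw [← hsum]
    exact Finset.sum_congr rfl fun k _ => by rw [smul_eq_C_mul]; rfl)
  exact Prod.ext (funext hz) (Prod.ext hα hβ)

theorem external_interp_of_isVandermondeFekete {Φ : ℕ → ℝ[X]}
    (hΦ : ∀ k, (Φ k).degree = (k : WithBot ℕ)) {m : ℕ} (hm : 2 ≤ m) {x : Fin (m + 1) → face i}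
    (h : IsVandermondeFekete fun j => faceCoord (x j)) (f : C(face i, ℝ)) :
    (∃! c, IsExternalInterp Φ x f c) ∧
      ∀ c, IsExternalInterp Φ x f c → ‖externalComb Φ f c‖ ≤ 16 * Real.log m * ‖f‖ := by
  set t : Fin (m + 1) → ℝ := fun j => faceCoord (x j)
  have hdeg : ∀ c, (sidePoly Φ (m - 1) c).degree < (Finset.univ : Finset (Fin (m + 1))).card := by
    intro c
    refine degree_le_natDegree.trans_lt ?_
    rw [Finset.card_fin]
    have := natDegree_sidePoly_le hΦ (m - 1) c
    exact_mod_cast (by omega : (sidePoly Φ (m - 1) c).natDegree < m + 1)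
  -- With the two end values left free there are `(m - 1) + 2` unknowns for `m + 1` nodes, a square
  -- system.
  let T : ((Fin (m - 1) → ℝ) × ℝ × ℝ) →ₗ[ℝ] (Fin (m + 1) → ℝ) :=
    (LinearMap.pi fun j => Polynomial.leval (t j)) ∘ₗ sidePoly Φ (m - 1)
  have hT : ∀ c j, T c j = (sidePoly Φ (m - 1) c).eval (t j) := fun _ _ => rfl
  have hTinj : Function.Injective T := by
    rw [injective_iff_map_eq_zero]
    intro c hc
    refine (map_eq_zero_iff _ (sidePoly_injective hΦ (m - 1))).mp ?_
    exact Polynomial.eq_zero_of_degree_lt_of_eval_index_eq_zero Finset.univ h.injective.injOn (hdeg c)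
      fun j _ => by rw [← hT, hc]; rfl
  have hTsurj : Function.Surjective T := by
    refine (LinearMap.injective_iff_surjective_of_finrank_eq_finrank ?_).mp hTinj
    simp only [Module.finrank_prod, Module.finrank_fin_fun, Module.finrank_self]
    omega
  have hinterp : ∀ c, IsExternalInterp Φ x f c ↔
      T (c, f (faceLeft i), f (faceRight i)) = fun j => f (x j) := fun c => by
    rw [funext_iff]
    exact forall_congr' fun j => by rw [externalComb_apply, hT]
  have hend : ∀ {τ : ℝ}, (lobatto m).eval τ = 0 → ∃ j, t j = τ := fun {τ} hτ => by
    have : τ ∈ Set.range t := h.range_eq (by omega) ▸ hτ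
    exact this
  refine ⟨?_, fun c hc => ?_⟩
  -- Both end points are nodes, so the free end values of the solution must be those of `f`.
  · obtain ⟨⟨c, α, β⟩, hc⟩ := hTsurj fun j => f (x j)
    obtain ⟨j0, h0⟩ := hend (τ := 0) (by simp [lobatto])
    obtain ⟨j1, h1⟩ := hend (τ := 1) (by simp [lobatto])
    have hα : α = f (faceLeft i) := by
      have hx : x j0 = faceLeft i := faceCoord_injective (h0.trans faceCoord_faceLeft.symm)
      rw [← hx, ← congrFun hc j0, hT, h0]
      simp [sidePoly]
    have hβ : β = f (faceRight i) := by
      have hx : x j1 = faceRight i := faceCoord_injective (h1.trans faceCoord_faceRight.symm)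
      rw [← hx, ← congrFun hc j1, hT, h1]
      simp [sidePoly]
    subst hα hβ
    refine ⟨c, (hinterp c).mpr hc, fun d hd => ?_⟩
    exact congrArg Prod.fst (hTinj (((hinterp d).mp hd).trans hc.symm))
  · have hlog : 0 ≤ Real.log m := Real.log_natCast_nonneg m
    refine (ContinuousMap.norm_le _ (by positivity)).mpr fun p => ?_
    have heq := Lagrange.eq_interpolate_of_eval_eq (s := Finset.univ) (v := t) (fun j => f (x j))
      h.injective.injOn (hdeg (c, f (faceLeft i), f (faceRight i)))
      fun j _ => by rw [← hT, (hinterp c).mp hc]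
    rw [externalComb_apply, heq, Lagrange.interpolate_apply, eval_finsetSum]
    calc ‖∑ j, (C (f (x j)) * Lagrange.basis Finset.univ t j).eval (faceCoord p)‖
        ≤ ∑ j, ‖f‖ * |(Lagrange.basis Finset.univ t j).eval (faceCoord p)| := by
          refine (norm_sum_le _ _).trans (Finset.sum_le_sum fun j _ => ?_)
          rw [eval_mul, eval_C, norm_mul, Real.norm_eq_abs (eval _ _)]
          exact mul_le_mul_of_nonneg_right (f.norm_coe_le_norm _) (abs_nonneg _)
      _ = ‖f‖ * ∑ j, |(Lagrange.basis Finset.univ t j).eval (faceCoord p)| := by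
          rw [Finset.mul_sum]
      _ ≤ ‖f‖ * (16 * Real.log m) :=
          mul_le_mul_of_nonneg_left (h.sum_abs_eval_basis_le hm (faceCoord_mem p)) (norm_nonneg _)
      _ = 16 * Real.log m * ‖f‖ := mul_comm _ _

end Face

end HPInterp

theorem theorem5p1 :
    (∃ C : ℝ, 0 < C ∧
      ∀ (Φ : ℕ → Polynomial ℝ), (∀ k, (Φ k).degree = (k : WithBot ℕ)) →
      ∀ (m : ℕ), 2 ≤ m → ∀ (i : Fin 3) (x : Fin (m + 1) → HPInterp.face i),
        HPInterp.IsFaceFekete x ∨ HPInterp.IsFaceGaussLobatto x →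
        ∀ f : C(HPInterp.face i, ℝ),
          (∃! c, HPInterp.IsExternalInterp Φ x f c) ∧
          ∀ c, HPInterp.IsExternalInterp Φ x f c →
            ‖HPInterp.externalComb Φ f c‖ ≤ C * Real.log m * ‖f‖) ∧
    (∀ (m : ℕ), 1 ≤ m →
      ∀ (B : Module.Basis (Fin (HPInterp.bubbleDim m)) ℝ (HPInterp.internalSpace m))
        (z : Fin (HPInterp.bubbleDim m) → HPInterp.refTriangle),
        HPInterp.IsFekete (fun j => (B j : C(HPInterp.refTriangle, ℝ))) z →
        ∀ f : C(HPInterp.refTriangle, ℝ),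
          (∃! a, HPInterp.IsInternalInterp B z f a) ∧
          ∀ a, HPInterp.IsInternalInterp B z f a →
            ‖HPInterp.internalComb B a‖ ≤ (HPInterp.bubbleDim m : ℝ) * ‖f‖) := by
  refine ⟨⟨16, by norm_num, fun Φ hΦ m hm i x hx f => ?_⟩, fun m _ B z hz f => ?_⟩
  · refine HPInterp.external_interp_of_isVandermondeFekete hΦ hm ?_ f
    rcases hx with hx | hx
    · exact hx.isVandermondeFekete
    · exact hx.isVandermondeFekete (by omega)
  · exact hz.existsUnique_and_norm_le
      (B.linearIndependent.map' (Submodule.subtype _) (Submodule.ker_subtype _)) f
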